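/- Let $L$ be an even lattice in a non-degenerate real quadratic space $(V,q)$ of signature $(b^+,b^-)$, with bilinear form $(x,y)=q(x+y)-q(x)-q(y)$ and dual lattice $L'$. Put $r=b^+-b^-$ and suppose that $L'/L$ has odd prime order $p$ (so $r$ is even). Write $e(z)=e^{2\pi i z}$ and let $\chi_p$ be the Legendre symbol modulo $p$. There is an isomorphism $L'/L\cong\mathbb F_p$ carrying $q \bmod 1$ to $\alpha x^2/p$ with some $\alpha\in\mathbb F_p\setminus\{0\}$; put $\epsilon=\chi_p(\alpha)$, which does not depend on choices. There is a unique representation $\rho$ of $\mathrm{SL}_2(\mathbb Z)$ on $\mathbb C[L'/L]$ (the Weil representation) with $$\rho(T)\mathfrak e_\gamma=e(q(\gamma))\mathfrak e_\gamma,\qquad \rho(S)\mathfrak e_\gamma=\frac{i^{-r/2}}{\sqrt{|L'/L|}}\sum_{\delta\in L'/L}e(-(\gamma,\delta))\mathfrak e_\delta,$$ where $T=\begin{pmatrix}1&1\\0&1\end{pmatrix}$ and $S=\begin{pmatrix}0&-1\\1&0\end{pmatrix}$. Let $k\in\mathbb Z$ with $k\equiv r/2\pmod 2$, and write $(f|M)(\tau)=(\det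 M)^{k/2}(c\tau+d)^{-k}f(M\tau)$ for a real matrix $M=\begin{pmatrix}a&b\\c&d\end{pmatrix}$ with $\det M>0$, and $W_p=\begin{pmatrix}0&-1\\p&0\end{pmatrix}$. * $A_k(p,\chi_p)$ is the space of holomorphic functions $f$ on the upper half-plane $\mathbb H$ with $f|M=\chi_p(d)f$ for all $M\in\Gamma_0(p)$ that are meromorphic at all cusps, and $A_k^\epsilon(p,\chi_p)$ is the subspace of those $f=\sum_n a(n)e(n\tau)$ with $a(n)=0$ whenever $\chi_p(n)=-\epsilon$. * $\mathcal A_{k,\rho}$ is the space of holomorphic functions $F=\sum_\gamma F_\gamma\mathfrak e_\gamma:\mathbb H\to\mathbb C[L'/L]$ with $F(M\tau)=(c\tau+d)^k\rho(M)F(\tau)$ for all $M\in\mathrm{SL}_2(\mathbb Z)$ and with Fourier expansions $F_\gamma=\sum_{n\in\mathbb Z+q(\gamma),\,n\gg-\infty}a(\gamma,n)e(n\tau)$. **Theorem.** Let $f=\sum_n a(n)e(n\tau)\in A_k^\epsilon(p,\chi_p)$. The terms of the sum $$F=i^{r/2}p^{k/2-1/2}\sum_{M\in\Gamma_0(p)\backslash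 \mathrm{SL}_2(\mathbb Z)}\left(\rho(M)^{-1}\mathfrak e_0\right)\, f|W_p|M$$ depend only on the cosets $\Gamma_0(p)M$, the function $F$ belongs to $\mathcal A_{k,\rho}$, and its components are $$F_0=2\sum_{n\equiv0\,(p)}a(n)e(n\tau/p),\qquad F_\gamma=\sum_{n\equiv pq(\gamma)\,(p)}a(n)e(n\tau/p)\quad(\gamma\neq0).$$ Moreover, the map $f\mapsto F$ and the map $$F\mapsto \frac{i^{r/2}}2\,p^{(1-k)/2}\,F_0|W_p=\frac12\sum_{\gamma\in L'/L}F_\gamma(p\tau)$$ are mutually inverse $\mathbb C$-linear isomorphisms between $A_k^\epsilon(p,\chi_p)$ and $\mathcal A_{k,\rho}$. -/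

import Mathlib

open scoped MatrixGroups UpperHalfPlane Manifold
open CongruenceSubgroup

noncomputable section

namespace PrimeDisc

/-- A non-degenerate real quadratic space `(V, Q)` together with an even lattice `L ⊂ V`, that is,
the `ℤ`-span of an `ℝ`-basis of `V` on which `Q` is integer valued. The associated bilinear form is
`(x, y) = Q (x + y) - Q x - Q y`, so that `Q x = (x, x) / 2`. -/
structure EvenLattice (V : Type*) [AddCommGroup V] [Module ℝ V] where
  /-- the quadratic form on the ambient real space -/
  Q : QuadraticForm ℝ V
  /-- the underlying `ℤ`-module of the lattice -/
  carrier : Submodule ℤ V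
  nondegenerate : LinearMap.BilinForm.Nondegenerate (QuadraticMap.polarBilin Q)
  isLattice : ∃ (m : ℕ) (b : Module.Basis (Fin m) ℝ V),
    carrier = Submodule.span ℤ (Set.range b)
  even : ∀ x ∈ carrier, ∃ n : ℤ, Q x = n

namespace EvenLattice

variable {V : Type*} [AddCommGroup V] [Module ℝ V] (L : EvenLattice V)

/-- The dual lattice `L' = {x ∈ V | (x, y) ∈ ℤ for all y ∈ L}`. -/
def dual : Submodule ℤ V :=
  LinearMap.BilinForm.dualSubmodule (QuadraticMap.polarBilin L.Q) L.carrier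

/-- The discriminant group `L' / L`. -/
abbrev Disc : Type _ := ↥L.dual ⧸ L.carrier.submoduleOf L.dual

/-- `r = b⁺ - b⁻`, where `(b⁺, b⁻)` is the signature. It is even when `|L'/L|` is odd. -/
def r : ℤ := (sigPos L.Q : ℤ) - (sigNeg L.Q : ℤ)

lemma mem_dual {x : V} :
    x ∈ L.dual ↔ ∀ y ∈ L.carrier, ∃ n : ℤ, QuadraticMap.polar L.Q x y = n := by
  unfold dual
  rw [LinearMap.BilinForm.mem_dualSubmodule]
  refine forall₂_congr fun y _ => ?_
  simp [Submodule.mem_one, eq_comm]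

lemma carrier_le_dual : L.carrier ≤ L.dual := by
  intro x hx
  rw [mem_dual]
  intro y hy
  obtain ⟨a, ha⟩ := L.even _ (L.carrier.add_mem hx hy)
  obtain ⟨b, hb⟩ := L.even _ hx
  obtain ⟨c, hc⟩ := L.even _ hy
  refine ⟨a - b - c, ?_⟩
  simp [QuadraticMap.polar, ha, hb, hc]

/-- The quadratic form `q : L'/L → ℝ/ℤ` induced by `Q`. -/
def q : L.Disc → UnitAddCircle :=
  Quotient.lift (fun x : L.dual => ((L.Q (x : V) : ℝ) : UnitAddCircle)) (by
    intro x y hxy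
    have h : x - y ∈ L.carrier.submoduleOf L.dual := (Submodule.quotientRel_def _).1 hxy
    have h' : (x : V) - (y : V) ∈ L.carrier := h
    obtain ⟨n, hn⟩ := L.even _ h'
    obtain ⟨m, hm⟩ := (L.mem_dual.1 y.2) _ h'
    have e1 : L.Q (x : V) = L.Q (y : V) + ((n + m : ℤ) : ℝ) := by
      have h1 : QuadraticMap.polar L.Q (y : V) ((x : V) - (y : V))
          = L.Q (x : V) - L.Q (y : V) - L.Q ((x : V) - (y : V)) := by
        simp [QuadraticMap.polar]
      rw [hm, hn] at h1
      push_cast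
      linarith
    have e2 : ((((n + m : ℤ) : ℝ)) : UnitAddCircle) = 0 :=
      (AddCircle.coe_eq_zero_iff (1 : ℝ)).2 ⟨n + m, by simp⟩
    simp only [e1, AddCircle.coe_add, e2, add_zero])

/-- The bilinear form `(γ, δ) = q (γ + δ) - q γ - q δ` on `L'/L` with values in `ℝ/ℤ`. -/
def bil (γ δ : L.Disc) : UnitAddCircle := QuadraticMap.polar L.q γ δ

lemma q_mk (x : L.dual) :
    L.q (Submodule.Quotient.mk x) = ((L.Q (x : V) : ℝ) : UnitAddCircle) := rfl

lemma bil_mk (x y : L.dual) : L.bil (Submodule.Quotient.mk x) (Submodule.Quotient.mk y)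
    = ((QuadraticMap.polar L.Q (x : V) (y : V) : ℝ) : UnitAddCircle) := by
  unfold bil QuadraticMap.polar
  rw [← Submodule.Quotient.mk_add, q_mk, q_mk, q_mk]
  simp

/-- The basis vector `𝔢_γ` of `ℂ[L'/L]`; elements of `ℂ[L'/L]` are written as coefficient functions
on the (finite) group `L'/L`. -/
def basisVec (γ : L.Disc) : L.Disc → ℂ :=
  open Classical in Pi.single γ 1

/-- The defining formulas of the Weil representation of `SL₂(ℤ)` on `ℂ[L'/L]`:
`ρ(T) 𝔢_γ = e(q(γ)) 𝔢_γ` and `ρ(S) 𝔢_γ = i^{-r/2} |L'/L|^{-1/2} ∑_δ e(-(γ,δ)) 𝔢_δ`.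
Here `AddCircle.toCircle` is the map `x mod 1 ↦ e(x) = exp(2πix)`. -/
def IsWeilRep (ρ : Representation ℂ SL(2, ℤ) (L.Disc → ℂ)) : Prop :=
  (∀ γ : L.Disc, ρ ModularGroup.T (L.basisVec γ)
      = (AddCircle.toCircle (L.q γ) : ℂ) • L.basisVec γ) ∧
  (∀ γ : L.Disc, ρ ModularGroup.S (L.basisVec γ)
      = fun δ => Complex.I ^ (-(L.r / 2)) / (Real.sqrt (Nat.card L.Disc) : ℂ) *
          (AddCircle.toCircle (-L.bil γ δ) : ℂ))

/-- The Weil representation `ρ_L`: the representation given by the formulas above on the generators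
`T` and `S` (unique, since these generate `SL₂(ℤ)`). -/
def weilRep : Representation ℂ SL(2, ℤ) (L.Disc → ℂ) :=
  Classical.epsilon L.IsWeilRep

/-- `φ` identifies the quadratic module `(L'/L, q)` with `(𝔽_p, α x² / p)`;
`ZMod.toAddCircle` is the map `j mod p ↦ j / p mod 1`. -/
def IsDiscIso (p : ℕ) [NeZero p] (φ : L.Disc ≃+ ZMod p) (α : ZMod p) : Prop :=
  α ≠ 0 ∧ ∀ γ : L.Disc, L.q γ = ZMod.toAddCircle (α * φ γ ^ 2)

/-- The sign `ε = χ_p(α)` of the quadratic form `q(x) = α x² / p` on `L'/L ≅ 𝔽_p`. -/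
def discSign (p : ℕ) [NeZero p] : ℤ :=
  open Classical in
  if ∃ (φ : L.Disc ≃+ ZMod p) (α : ZMod p), L.IsDiscIso p φ α ∧ IsSquare α then 1 else -1

end EvenLattice

/-- `e(z) = exp(2πiz)`. -/
def e (z : ℂ) : ℂ := Complex.exp (2 * Real.pi * Complex.I * z)

/-- The Petersson slash operator
`(f ∣_k M)(τ) = (det M)^{k/2} (cτ + d)^{-k} f(Mτ)`, used only for `det M > 0`. -/
def slash (k : ℤ) (f : ℍ → ℂ) (M : GL (Fin 2) ℝ) : ℍ → ℂ := fun τ =>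
  ((((M.det : ℝ) ^ ((k : ℝ) / 2) : ℝ)) : ℂ) * UpperHalfPlane.denom M τ ^ (-k) * f (M • τ)

/-- `f = ∑_n a(n) e(nτ)` on the upper half-plane, with `a(n) = 0` for `n ≪ 0`. -/
def HasQExpansion (f : ℍ → ℂ) (a : ℤ → ℂ) : Prop :=
  (∃ N : ℤ, ∀ n < N, a n = 0) ∧
  ∀ τ : ℍ, HasSum (fun n : ℤ => a n * e (n * τ)) (f τ)

/-- `g = ∑_n c(n) e(nτ/p)` with `c(n) = 0` for `n ≪ 0`. For `g = f ∣_k M`, `M ∈ SL₂(ℤ)`, and `f`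
transforming under `Γ₀(p)` with character `χ_p`, this says that `f` is meromorphic at the cusp
`M∞` (every cusp of `Γ₀(p)` has width dividing `p`). -/
def IsMeromorphicAtInfty (p : ℕ) (g : ℍ → ℂ) : Prop :=
  ∃ c : ℤ → ℂ, (∃ N : ℤ, ∀ n < N, c n = 0) ∧
    ∀ τ : ℍ, HasSum (fun n : ℤ => c n * e (n * τ / p)) (g τ)

/-- `A_k(p, χ_p)`: nearly holomorphic modular forms of weight `k` for `Γ₀(p)` with character `χ_p`,
i.e. holomorphic functions on the upper half-plane with `f ∣_k M = χ_p(d) f` for `M ∈ Γ₀(p)` that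
are meromorphic at all cusps. -/
def scalarForms (p : ℕ) [Fact p.Prime] (k : ℤ) : Submodule ℂ (ℍ → ℂ) where
  carrier := {f | MDifferentiable 𝓘(ℂ) 𝓘(ℂ) f ∧
    (∀ M ∈ Gamma0 p, ∀ τ : ℍ, slash k f (M : GL (Fin 2) ℝ) τ
      = (legendreSym p (M 1 1) : ℂ) * f τ) ∧
    ∀ M : SL(2, ℤ), IsMeromorphicAtInfty p (slash k f (M : GL (Fin 2) ℝ))}
  zero_mem' := by
    refine ⟨mdifferentiable_const, ?_, ?_⟩
    · intro M _ τ
      simp [slash]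
    · intro M
      exact ⟨0, ⟨0, by simp⟩, fun τ => by simp [slash]⟩
  add_mem' := by
    rintro f g ⟨hf, hf', hf''⟩ ⟨hg, hg', hg''⟩
    refine ⟨hf.add hg, ?_, ?_⟩
    · intro M hM τ
      have h1 := hf' M hM τ
      have h2 := hg' M hM τ
      simp only [slash, Pi.add_apply, mul_add] at *
      rw [h1, h2]
    · intro M
      obtain ⟨c, ⟨N, hN⟩, hc⟩ := hf'' M
      obtain ⟨c', ⟨N', hN'⟩, hc'⟩ := hg'' M
      refine ⟨c + c', ⟨min N N', fun n hn => ?_⟩, fun τ => ?_⟩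
      · simp [hN n (lt_of_lt_of_le hn (min_le_left _ _)),
          hN' n (lt_of_lt_of_le hn (min_le_right _ _))]
      · have := (hc τ).add (hc' τ)
        simpa [slash, mul_add, add_mul] using this
  smul_mem' := by
    rintro t f ⟨hf, hf', hf''⟩
    refine ⟨hf.const_smul t, ?_, ?_⟩
    · intro M hM τ
      have h1 := hf' M hM τ
      simp only [slash, Pi.smul_apply, smul_eq_mul] at *
      rw [mul_left_comm, h1, mul_left_comm]
    · intro M
      obtain ⟨c, ⟨N, hN⟩, hc⟩ := hf'' M
      refine ⟨t • c, ⟨N, fun n hn => by simp [hN n hn]⟩, fun τ => ?_⟩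
      have := (hc τ).mul_left t
      simpa only [slash, Pi.smul_apply, smul_eq_mul, mul_left_comm t, mul_assoc] using this

/-- `A_k^ε(p, χ_p)`: the forms `f = ∑ a(n) qⁿ` in `A_k(p, χ_p)` with `a(n) = 0` whenever
`χ_p(n) = -ε`. -/
def signedForms (p : ℕ) [Fact p.Prime] (k : ℤ) (ε : ℤ) : Submodule ℂ (ℍ → ℂ) where
  carrier := {f | f ∈ scalarForms p k ∧
    ∃ a : ℤ → ℂ, HasQExpansion f a ∧ ∀ n : ℤ, legendreSym p n = -ε → a n = 0}
  zero_mem' := ⟨Submodule.zero_mem _, 0, ⟨⟨0, by simp⟩, fun τ => by simp⟩,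
    by simp⟩
  add_mem' := by
    rintro f g ⟨hf, a, ⟨⟨N, hN⟩, ha⟩, ha'⟩ ⟨hg, b, ⟨⟨N', hN'⟩, hb⟩, hb'⟩
    refine ⟨Submodule.add_mem _ hf hg, a + b, ⟨⟨min N N', fun n hn => ?_⟩, fun τ => ?_⟩, ?_⟩
    · simp [hN n (lt_of_lt_of_le hn (min_le_left _ _)),
        hN' n (lt_of_lt_of_le hn (min_le_right _ _))]
    · simpa [add_mul] using (ha τ).add (hb τ)
    · intro n hn
      simp [ha' n hn, hb' n hn]
  smul_mem' := by
    rintro t f ⟨hf, a, ⟨⟨N, hN⟩, ha⟩, ha'⟩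
    refine ⟨Submodule.smul_mem _ t hf, t • a, ⟨⟨N, fun n hn => by simp [hN n hn]⟩, fun τ => ?_⟩,
      fun n hn => by simp [ha' n hn]⟩
    simpa [mul_assoc] using (ha τ).mul_left t

variable {V : Type*} [AddCommGroup V] [Module ℝ V] (L : EvenLattice V)

/-- `𝒜_{k,ρ}`: nearly holomorphic modular forms of weight `k` for `SL₂(ℤ)` with the Weil
representation `ρ = ρ_L`: holomorphic `F = ∑ F_γ 𝔢_γ` (written `F τ γ = F_γ(τ)`) with
`F(Mτ) = (cτ + d)^k ρ(M) F(τ)` and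
`F_γ = ∑ a(γ, n) e(nτ)`, where `n` runs over `ℤ + q(γ)` and is bounded below on the support. -/
def vectorForms (k : ℤ) : Submodule ℂ (ℍ → L.Disc → ℂ) where
  carrier := {F | (∀ γ : L.Disc, MDifferentiable 𝓘(ℂ) 𝓘(ℂ) (fun τ : ℍ => F τ γ)) ∧
    (∀ (M : SL(2, ℤ)) (τ : ℍ),
      F (M • τ) = UpperHalfPlane.denom (M : GL (Fin 2) ℝ) τ ^ k • L.weilRep M (F τ)) ∧
    ∀ γ : L.Disc, ∃ a : {x : ℝ // (x : UnitAddCircle) = L.q γ} → ℂ,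
      (∃ N : ℝ, ∀ n : {x : ℝ // (x : UnitAddCircle) = L.q γ}, (n : ℝ) < N → a n = 0) ∧
      ∀ τ : ℍ, HasSum (fun n => a n * e ((n : ℝ) * τ)) (F τ γ)}
  zero_mem' := by
    refine ⟨fun γ => mdifferentiable_const, fun M τ => by simp, fun γ => ?_⟩
    exact ⟨0, ⟨0, by simp⟩, fun τ => by simp⟩
  add_mem' := by
    rintro F G ⟨hF, hF', hF''⟩ ⟨hG, hG', hG''⟩
    refine ⟨fun γ => (hF γ).add (hG γ), fun M τ => ?_, fun γ => ?_⟩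
    · rw [Pi.add_apply, Pi.add_apply, hF' M τ, hG' M τ, map_add, smul_add]
    · obtain ⟨a, ⟨N, hN⟩, ha⟩ := hF'' γ
      obtain ⟨b, ⟨N', hN'⟩, hb⟩ := hG'' γ
      refine ⟨a + b, ⟨min N N', fun n hn => ?_⟩, fun τ => ?_⟩
      · simp [hN n (lt_of_lt_of_le hn (min_le_left _ _)),
          hN' n (lt_of_lt_of_le hn (min_le_right _ _))]
      · simpa [add_mul] using (ha τ).add (hb τ)
  smul_mem' := by
    rintro t F ⟨hF, hF', hF''⟩
    refine ⟨fun γ => (hF γ).const_smul t, fun M τ => ?_, fun γ => ?_⟩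
    · rw [Pi.smul_apply, Pi.smul_apply, hF' M τ, map_smul, smul_comm t]
    · obtain ⟨a, ⟨N, hN⟩, ha⟩ := hF'' γ
      refine ⟨t • a, ⟨N, fun n hn => by simp [hN n hn]⟩, fun τ => ?_⟩
      simpa [mul_assoc] using (ha τ).mul_left t

/-- The Fricke involution `W_p`, with rows `(0, -1)` and `(p, 0)`. -/
def fricke (p : ℕ) [Fact p.Prime] : GL (Fin 2) ℝ :=
  Matrix.GeneralLinearGroup.mkOfDetNeZero !![0, -1; (p : ℝ), 0]
    (by simpa [Matrix.det_fin_two] using (Fact.out : p.Prime).ne_zero)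

/-- The point `pτ` of the upper half-plane. -/
def scale (p : ℕ) [Fact p.Prime] (τ : ℍ) : ℍ :=
  ⟨(p : ℂ) * τ, by
    have h : (0 : ℝ) < p := by exact_mod_cast (Fact.out : p.Prime).pos
    simpa using mul_pos h τ.im_pos⟩

/-- The term `(ρ(M)⁻¹ 𝔢_0) · f ∣ W_p ∣ M`. -/
def inducedTerm (p : ℕ) [Fact p.Prime] (k : ℤ) (f : ℍ → ℂ) (M : SL(2, ℤ)) :
    ℍ → L.Disc → ℂ := fun τ =>
  slash k (slash k f (fricke p)) (M : GL (Fin 2) ℝ) τ • L.weilRep M⁻¹ (L.basisVec 0)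

/-- The induced function
`F = i^{r/2} p^{k/2-1/2} ∑_{M ∈ Γ₀(p)\SL₂(ℤ)} (ρ(M)⁻¹ 𝔢_0) f ∣ W_p ∣ M`; the sum is over the finite
set of cosets `Γ₀(p) M`, with one representative taken in each. -/
def induced (p : ℕ) [Fact p.Prime] (k : ℤ) (f : ℍ → ℂ) : ℍ → L.Disc → ℂ := fun τ =>
  (Complex.I ^ (L.r / 2) * (((p : ℝ) ^ ((k : ℝ) / 2 - 1 / 2) : ℝ) : ℂ)) •
    ∑ᶠ c : Quotient (QuotientGroup.rightRel (Gamma0 p)), inducedTerm L p k f c.out τ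

/-- The map `F ↦ (i^{r/2} / 2) p^{(1-k)/2} F_0 ∣ W_p`. -/
def toScalar (p : ℕ) [Fact p.Prime] (k : ℤ) (F : ℍ → L.Disc → ℂ) : ℍ → ℂ := fun τ =>
  Complex.I ^ (L.r / 2) / 2 * (((p : ℝ) ^ ((1 - (k : ℝ)) / 2) : ℝ) : ℂ) *
    slash k (fun z => F z 0) (fricke p) τ

end PrimeDisc

end

open PrimeDisc

/-!
The Weil representation is constructed explicitly. On functions on `𝔽_p ≅ L'/L` let the matrix
with rows `(a, b)`, `(c, d)` act by a substitution if `p ∣ c` and by a Gaussian kernel otherwise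
(`weilOp`). That these operators multiply correctly need only be seen for right multiplication by
the generators `S` and `T`, where it comes down to evaluating quadratic Gauss sums over `𝔽_p`
(`weilOpSL_mul`). It holds exactly if the factor `i^{-r/2} / √p` in the action of `S` is the
inverse of the Gauss sum of the discriminant form, which is Milgram's formula
(`EvenLattice.milgram`). That formula is proved by comparing `L` with an orthogonal sublattice:
the Gauss sum of the sublattice factors into one-dimensional sums, whose phase comes from the
asymptotics of the Jacobi theta function at a rational cusp (`sum_exp_sq_div`), and it is a
positive multiple of the Gauss sum of `L` because `L` modulo the sublattice is isotropic
(`sum_toCircle_eq_card_ker_mul`).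

For `M = S T^j` the function `f ∣ W_p ∣ M` is a multiple of `f((τ + j) / p)`, so the sum over
these `p` cosets sorts the expansion of `f` by residue classes: its component at `γ` is the part
of `∑ a(n) e(nτ/p)` with `n ≡ p q(γ)` modulo `p` (`induced_apply`). The identity coset contributes
a multiple of `f ∣ W_p` to the zero component only. That this equals the part with `p ∣ n`
(`inducedConst_mul_slash_fricke`) is where the condition on the coefficients enters: it makes the
residue classes `α x²` cover `f` twice, up to the class of zero, and then the transformation law
of `F` under `S` says that the difference `u` of the two functions satisfies `u(-1/τ) = -κ τ^k
u(τ)` with `κ² = (-1)^k / p`. Applying this twice gives `u = u / p`, so `u = 0`.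

In the other direction, the law under `S` gives `F_0 ∣ W_p` the form `½ ∑_γ F_γ(pτ)` up to the
constant (`toScalar_apply`), which has the required expansion; composed with the induced function
it returns `f` (`toScalar_induced`). It is injective since `F_0` determines `F`: the laws under `S
T^j` recover from `F_0` the sums `F_γ + F_{-γ}`, and `F` is even by the law under `-1`
(`eq_zero_of_toScalar_eq_zero`). Hence both maps are bijective.
-/

/-! ### The sign of quadratic Gauss sums -/

open Complex Filter Topology HurwitzZeta in
/-- Near the cusp `1 / 2a`, the theta function splits into one theta kernel for each residue class
modulo `2a`, weighted by the terms of a quadratic Gauss sum. -/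
theorem jacobiTheta_one_div_add (a : ℕ) (ha : 0 < a) {t : ℝ} (ht : 0 < t) :
    jacobiTheta (1 / (2 * a) + I / (4 * a ^ 2 * t)) =
      ∑ x : Fin (2 * a), cexp (Real.pi * I * x ^ 2 / (2 * a)) *
        (evenKernel ((x / (2 * a) : ℝ) : UnitAddCircle) (1 / t) : ℂ) := by
  have : NeZero (2 * a) := ⟨by omega⟩
  have ha' : (a : ℂ) ≠ 0 := by exact_mod_cast ha.ne'
  have ht' : (t : ℂ) ≠ 0 := by exact_mod_cast ht.ne'
  set τ : ℂ := 1 / (2 * a) + I / (4 * a ^ 2 * t) with hτ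
  have him : 0 < τ.im := by
    have : τ = ((1 / (2 * a) : ℝ) : ℂ) + ((1 / (4 * a ^ 2 * t) : ℝ) : ℂ) * I := by
      rw [hτ]; push_cast; ring
    rw [this]
    simp only [add_im, ofReal_im, mul_I_im, ofReal_re, zero_add]
    positivity
  have h1 : HasSum (fun n : ℤ => cexp (Real.pi * I * (n : ℂ) ^ 2 * τ)) (jacobiTheta τ) := by
    have := hasSum_jacobiTheta₂_term 0 him
    simpa [jacobiTheta₂_term, ← jacobiTheta_eq_jacobiTheta₂] using this
  rw [← (((Equiv.prodComm _ _).trans (Int.divModEquiv (2 * a)).symm)).hasSum_iff] at h1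
  have h2 := h1.prod_fiberwise (g := fun x : Fin (2 * a) =>
    cexp (Real.pi * I * x ^ 2 / (2 * a)) *
        (evenKernel ((x / (2 * a) : ℝ) : UnitAddCircle) (1 / t) : ℂ)) (fun x => by
    have h3 := (hasSum_ofReal.mpr
      (hasSum_int_evenKernel ((x : ℝ) / (2 * a)) (one_div_pos.mpr ht))).mul_left
        (cexp (Real.pi * I * x ^ 2 / (2 * a)))
    refine h3.congr_fun fun n => ?_
    simp only [Function.comp, Equiv.coe_trans, Equiv.prodComm_apply, Prod.swap,
      Int.divModEquiv_symm_apply]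
    push_cast
    rw [← Complex.exp_add]
    -- `π i (2an + x)² / 2a` and `π i x² / 2a` differ by `2πi (a n² + n x)`
    refine Complex.exp_eq_exp_iff_exists_int.mpr ⟨a * n ^ 2 + n * x, ?_⟩
    rw [hτ]
    push_cast
    field_simp
    ring_nf
    simp only [I_sq]
    ring)
  exact h2.unique (hasSum_fintype _)

open Complex Filter Topology HurwitzZeta in
/-- The same value of the theta function, moved to a neighbourhood of the cusp at infinity by
`z ↦ -1 / z`, a translation by `-2a` and `z ↦ -1 / z` once more. -/
theorem jacobiTheta_one_div_add' (a : ℕ) (ha : 0 < a) {t : ℝ} (ht : 0 < t) :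
    jacobiTheta (1 / (2 * a) + I / (4 * a ^ 2 * t)) =
      (-2 * a * t / (I * t - 1 / (2 * a))) ^ (1 / 2 : ℂ) * ((t : ℂ) + I / (2 * a)) ^ (1 / 2 : ℂ) *
        jacobiTheta (I * t - 1 / (2 * a)) := by
  have ha' : (a : ℂ) ≠ 0 := by exact_mod_cast ha.ne'
  have ht' : (t : ℂ) ≠ 0 := by exact_mod_cast ht.ne'
  have key : ∀ z : ℂ, 0 < z.im → jacobiTheta (-1 / z) = (-I * z) ^ (1 / 2 : ℂ) * jacobiTheta z := by
    intro z hz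
    have := jacobiTheta_S_smul ⟨z, hz⟩
    rw [UpperHalfPlane.modular_S_smul] at this
    rw [← this]
    congr 1
    simp [neg_div, inv_neg]
  have hinv : ∀ z : ℂ, 0 < z.im → 0 < (-1 / z).im := by
    intro z hz
    have := (ModularGroup.S • (⟨z, hz⟩ : ℍ)).im_pos
    rw [UpperHalfPlane.modular_S_smul] at this
    convert this using 1
    simp [neg_div, inv_neg, UpperHalfPlane.im]
  have hper : ∀ (z : ℂ) (n : ℕ), jacobiTheta (z - 2 * n) = jacobiTheta z := by
    intro z n
    induction n with
    | zero => simp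
    | succ n ih =>
      rw [← ih, ← jacobiTheta_two_add (z - 2 * ((n + 1 : ℕ) : ℂ))]
      congr 1
      push_cast; ring
  set σ : ℂ := I * t - 1 / (2 * a) with hσ
  have hσ' : σ = ((-1 / (2 * a) : ℝ) : ℂ) + ((t : ℝ) : ℂ) * I := by
    rw [hσ]; push_cast; ring
  have hσim : 0 < σ.im := by
    rw [hσ']
    simpa only [add_im, ofReal_im, mul_I_im, ofReal_re, zero_add] using ht
  have hσ0 : σ ≠ 0 := fun h => by rw [h] at hσim; simp at hσim
  have hwim : 0 < (-1 / σ - 2 * a).im := by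
    have := hinv σ hσim
    simpa using this
  have e1 := key _ hwim
  rw [hper, key σ hσim] at e1
  have eq1 : -1 / (-1 / σ - 2 * a) = 1 / (2 * a) + I / (4 * a ^ 2 * t) := by
    have : (-1 / σ - 2 * a) = - (2 * a * I * t) / σ := by
      rw [div_sub' hσ0]
      congr 1
      rw [hσ]; field_simp; ring
    rw [this, hσ]
    field_simp
    ring_nf
    simp only [I_sq]; ring
  have eq2 : -I * (-1 / σ - 2 * a) = -2 * a * t / σ := by
    have : (-1 / σ - 2 * a) = - (2 * a * I * t) / σ := by
      rw [div_sub' hσ0]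
      congr 1
      rw [hσ]; field_simp; ring
    rw [this]
    field_simp
    simp only [I_sq]
  have eq3 : -I * σ = (t : ℂ) + I / (2 * a) := by
    rw [hσ]
    linear_combination (-(t : ℂ)) * I_mul_I
  rw [eq1, eq2, eq3] at e1
  rw [e1]; ring

open Complex Filter Topology HurwitzZeta in
/-- The quadratic Gauss sum modulo `2a`, sign included: compare the leading terms, as `t → ∞`, of
the two evaluations of the theta function at `1 / 2a + i / (4a²t)`. -/
theorem sum_exp_sq_div (a : ℕ) (ha : 0 < a) :
    ∑ x : Fin (2 * a), cexp (Real.pi * I * x ^ 2 / (2 * a)) =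
      Real.sqrt (2 * a) * cexp (Real.pi * I / 4) := by
  have ha' : (a : ℂ) ≠ 0 := by exact_mod_cast ha.ne'
  have hcos : ∀ b : UnitAddCircle, Tendsto (fun t : ℝ => (cosKernel b t : ℂ)) atTop (𝓝 1) := by
    intro b
    obtain ⟨c, hc, hO⟩ := isBigO_atTop_cosKernel_sub b
    have h0 : Tendsto (fun x : ℝ => Real.exp (-c * x)) atTop (𝓝 0) := by
      refine Real.tendsto_exp_atBot.comp ?_
      exact tendsto_id.const_mul_atTop_of_neg (by linarith)
    have := (hO.trans_tendsto h0).add_const 1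
    simp only [sub_add_cancel, zero_add] at this
    exact_mod_cast (continuous_ofReal.tendsto _).comp this
  have hinv : Tendsto (fun t : ℝ => ((t : ℂ))⁻¹) atTop (𝓝 0) := by
    have := (continuous_ofReal.tendsto _).comp tendsto_inv_atTop_zero
    simpa [Function.comp_def] using this
  have htheta : Tendsto (fun t : ℝ => jacobiTheta (I * t - 1 / (2 * a))) atTop (𝓝 1) := by
    have hc : Tendsto (fun t : ℝ => (I * t - 1 / (2 * a) : ℂ)) atTop (comap im atTop) := by
      rw [tendsto_comap_iff]
      have : (im ∘ fun t : ℝ => (I * t - 1 / (2 * a) : ℂ)) = fun t => t := by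
        ext t
        have : (I * t - 1 / (2 * a) : ℂ) = ((-1 / (2 * a) : ℝ) : ℂ) + ((t : ℝ) : ℂ) * I := by
          push_cast; ring
        simp only [Function.comp, this, add_im, ofReal_im, mul_I_im, ofReal_re, zero_add]
      rw [this]; exact tendsto_id
    have h0 : Tendsto (fun τ : ℂ => Real.exp (-Real.pi * τ.im)) (comap im atTop) (𝓝 0) := by
      refine Real.tendsto_exp_atBot.comp ?_
      exact (tendsto_comap (f := im)).const_mul_atTop_of_neg (by linarith [Real.pi_pos])
    have := ((isBigO_at_im_infty_jacobiTheta_sub_one.trans_tendsto h0).comp hc).add_const 1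
    simpa [Function.comp_def] using this
  have hL : Tendsto (fun t : ℝ => ∑ x : Fin (2 * a), cexp (Real.pi * I * x ^ 2 / (2 * a)) *
      (cosKernel ((x / (2 * a) : ℝ) : UnitAddCircle) t : ℂ)) atTop
      (𝓝 (∑ x : Fin (2 * a), cexp (Real.pi * I * x ^ 2 / (2 * a)) * 1)) :=
    tendsto_finsetSum _ fun x _ => (hcos _).const_mul _
  have hR : Tendsto (fun t : ℝ => (-2 * a / (I - (t : ℂ)⁻¹ / (2 * a))) ^ (1 / 2 : ℂ) *
      (1 + (t : ℂ)⁻¹ * I / (2 * a)) ^ (1 / 2 : ℂ) * jacobiTheta (I * t - 1 / (2 * a))) atTop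
      (𝓝 ((-2 * a / (I - 0 / (2 * a))) ^ (1 / 2 : ℂ) *
      (1 + 0 * I / (2 * a)) ^ (1 / 2 : ℂ) * 1)) := by
    have haa : (-2 * a / I : ℂ) = 2 * a * I := by
      field_simp
      simp [I_sq]
    refine (Tendsto.mul ?_ ?_).mul htheta
    · refine Tendsto.cpow ?_ tendsto_const_nhds ?_
      · exact tendsto_const_nhds.div (tendsto_const_nhds.sub (hinv.div_const _)) (by simp)
      · right
        rw [zero_div, sub_zero, haa]
        simpa using ha.ne'
    · refine Tendsto.cpow ?_ tendsto_const_nhds ?_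
      · exact tendsto_const_nhds.add ((hinv.mul_const _).div_const _)
      · left; simp
  have heq : (fun t : ℝ => ∑ x : Fin (2 * a), cexp (Real.pi * I * x ^ 2 / (2 * a)) *
      (cosKernel ((x / (2 * a) : ℝ) : UnitAddCircle) t : ℂ)) =ᶠ[atTop]
      (fun t : ℝ => (-2 * a / (I - (t : ℂ)⁻¹ / (2 * a))) ^ (1 / 2 : ℂ) *
      (1 + (t : ℂ)⁻¹ * I / (2 * a)) ^ (1 / 2 : ℂ) * jacobiTheta (I * t - 1 / (2 * a))) := by
    filter_upwards [eventually_gt_atTop 0] with t ht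
    have ht' : (t : ℂ) ≠ 0 := by exact_mod_cast ht.ne'
    have ht2 : (t : ℂ) ^ (1 / 2 : ℂ) ≠ 0 := by simp [cpow_eq_zero_iff, ht']
    refine mul_left_cancel₀ ht2 ?_
    have e1 : (t : ℂ) + I / (2 * a) = (t : ℂ) * (1 + (t : ℂ)⁻¹ * I / (2 * a)) := by
      field_simp
    have e2 : -2 * a * t / (I * t - 1 / (2 * a)) = (-2 * a / (I - (t : ℂ)⁻¹ / (2 * a)) : ℂ) := by
      rw [show (I * t - 1 / (2 * a) : ℂ) = (I - (t : ℂ)⁻¹ / (2 * a)) * t by field_simp,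
        mul_div_mul_right _ _ ht']
    have h := (jacobiTheta_one_div_add a ha ht).symm.trans (jacobiTheta_one_div_add' a ha ht)
    have e3 : ((t : ℂ) * (1 + (t : ℂ)⁻¹ * I / (2 * a))) ^ (1 / 2 : ℂ)
        = (t : ℂ) ^ (1 / 2 : ℂ) * (1 + (t : ℂ)⁻¹ * I / (2 * a)) ^ (1 / 2 : ℂ) := by
      have hn : (1 + (t : ℂ)⁻¹ * I / (2 * a)) ≠ 0 := fun h0 => by
        have : (1 + (t : ℂ)⁻¹ * I / (2 * a)) = ((1 : ℝ) : ℂ) + ((t⁻¹ / (2 * a) : ℝ) : ℂ) * I := by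
          push_cast; ring
        rw [this] at h0
        have h1 := congrArg re h0
        rw [add_re, ofReal_re, re_ofReal_mul, I_re] at h1
        norm_num at h1
      rw [cpow_def_of_ne_zero (mul_ne_zero ht' hn), cpow_def_of_ne_zero ht',
        cpow_def_of_ne_zero hn, log_ofReal_mul ht hn, ← Complex.exp_add, ← ofReal_log ht.le,
        add_mul]
    rw [e2, e1, e3] at h
    have h2 : ∀ b : UnitAddCircle, (evenKernel b (1 / t) : ℂ)
        = (t : ℂ) ^ (1 / 2 : ℂ) * cosKernel b t := by
      intro b
      rw [evenKernel_functional_equation, one_div_one_div]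
      rw [one_div t, Real.inv_rpow ht.le, one_div, inv_inv, ofReal_mul, ofReal_cpow ht.le]
      push_cast
      rfl
    simp only [h2] at h
    rw [Finset.mul_sum]
    calc _ = _ := Finset.sum_congr rfl fun x _ => by ring
      _ = _ := h
      _ = _ := by ring
  have := tendsto_nhds_unique (hL.congr' heq) hR
  simp only [mul_one, zero_div, sub_zero, zero_mul, add_zero, one_cpow] at this
  have haa : (-2 * a / I : ℂ) = ((2 * a : ℝ) : ℂ) * I := by
    push_cast
    field_simp
    simp [I_sq]
  have hp : (0 : ℝ) < 2 * a := by positivity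
  have hp' : ((2 * a : ℝ) : ℂ) ≠ 0 := by exact_mod_cast hp.ne'
  rw [this, haa, cpow_def_of_ne_zero (mul_ne_zero hp' I_ne_zero), log_ofReal_mul hp I_ne_zero,
    log_I, add_mul, Complex.exp_add, Real.sqrt_eq_rpow, ofReal_cpow hp.le, cpow_def_of_ne_zero hp',
    ofReal_log hp.le]
  push_cast
  congr 2
  ring

open Complex in
theorem toCircle_intCast_div (K : ℕ) [NeZero K] (j : ℤ) :
    (AddCircle.toCircle (ZMod.toAddCircle (j : ZMod K)) : ℂ) = cexp (2 * Real.pi * I * j / K) := by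
  rw [ZMod.toAddCircle_intCast, AddCircle.toCircle_apply_mk, Circle.coe_exp]
  push_cast
  congr 1
  ring

theorem sum_zmod_eq_sum_fin (K : ℕ) [NeZero K] (F : ZMod K → ℂ) :
    ∑ x : ZMod K, F x = ∑ x : Fin K, F ((x : ℕ) : ZMod K) := by
  refine (Finset.sum_bij' (s := (Finset.univ : Finset (Fin K)))
    (t := (Finset.univ : Finset (ZMod K)))
    (fun x _ => ((x : ℕ) : ZMod K)) (fun x _ => (⟨x.val, ZMod.val_lt x⟩ : Fin K))
    ?_ ?_ ?_ ?_ ?_).symm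
  · simp
  · simp
  · intro x _
    ext
    simp [ZMod.val_natCast, Nat.mod_eq_of_lt x.2]
  · simp
  · simp

open Complex in
/-- The sum over `ZMod K` runs `2k` times through a Gauss sum modulo `2a`. -/
theorem sum_toCircle_sq_pos (a k K : ℕ) [NeZero K] (ha : 0 < a) (hk : k * (4 * a) = K) :
    ∃ C : ℝ, 0 < C ∧
      ∑ x : ZMod K, (AddCircle.toCircle (ZMod.toAddCircle ((k : ZMod K) * x ^ 2)) : ℂ) =
        C * cexp (Real.pi * I / 4) := by
  have hK := NeZero.pos K
  have hk0 : 0 < k := Nat.pos_of_ne_zero fun h => by simp [h] at hk; omega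
  refine ⟨2 * k * Real.sqrt (2 * a), by positivity, ?_⟩
  have ha' : (a : ℂ) ≠ 0 := by exact_mod_cast ha.ne'
  have hk' : (k : ℂ) ≠ 0 := by exact_mod_cast hk0.ne'
  have e1 : ∀ x : ℕ, (AddCircle.toCircle (ZMod.toAddCircle ((k : ZMod K) * (x : ZMod K) ^ 2)) : ℂ)
      = cexp (Real.pi * I * x ^ 2 / (2 * a)) := by
    intro x
    have := toCircle_intCast_div K (k * x ^ 2)
    push_cast at this
    rw [this, ← hk]
    congr 1
    push_cast
    field_simp
    ring
  rw [sum_zmod_eq_sum_fin]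
  simp only [e1]
  have h2 : (2 * k) * (2 * a) = K := by rw [← hk]; ring
  subst h2
  rw [← finProdFinEquiv.sum_comp, Fintype.sum_prod_type]
  have e2 : ∀ (x : Fin (2 * k)) (y : Fin (2 * a)),
      cexp (Real.pi * I * ((finProdFinEquiv (x, y) : Fin _) : ℕ) ^ 2 / (2 * a))
        = cexp (Real.pi * I * y ^ 2 / (2 * a)) := by
    intro x y
    refine Complex.exp_eq_exp_iff_exists_int.mpr ⟨a * x ^ 2 + x * y, ?_⟩
    simp only [finProdFinEquiv_apply_val]
    push_cast
    field_simp
    ring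
  simp only [e2, sum_exp_sq_div a ha, Finset.sum_const, Finset.card_univ, Fintype.card_fin]
  push_cast
  simp
  ring

open Complex in
/-- The quadratic Gauss sum with its sign: the phase of `∑ e(x² / 4a)` over `x mod 4ak` is an
eighth root of unity depending only on the sign of `a`. -/
theorem sum_toCircle_sq (a k : ℤ) (K : ℕ) [NeZero K] (hk : k * (4 * a) = K) :
    ∃ C : ℝ, 0 < C ∧
      ∑ x : ZMod K, (AddCircle.toCircle (ZMod.toAddCircle ((k : ZMod K) * x ^ 2)) : ℂ) =
        C * cexp (Real.pi * I / 4 * a.sign) := by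
  have hK : (0 : ℤ) < K := by exact_mod_cast NeZero.pos K
  rcases lt_trichotomy a 0 with ha | rfl | ha
  -- for negative `a` the sum is the complex conjugate of the one for `-a`
  · obtain ⟨b, hb⟩ := Int.exists_eq_neg_ofNat ha.le
    obtain ⟨l, hl⟩ := Int.exists_eq_neg_ofNat (show k ≤ 0 by nlinarith)
    subst hb hl
    obtain ⟨C, hC, h⟩ := sum_toCircle_sq_pos b l K (by omega) (by
      have : (l : ℤ) * (4 * b) = K := by rw [← hk]; ring
      exact_mod_cast this)
    refine ⟨C, hC, ?_⟩
    have h' := congrArg (starRingEnd ℂ) h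
    rw [map_sum] at h'
    simp only [← Circle.coe_inv_eq_conj, ← AddCircle.toCircle_neg, ← map_neg] at h'
    rw [Int.sign_eq_neg_one_of_neg ha]
    push_cast
    simp only [← neg_mul] at h'
    rw [h', map_mul, ← Complex.exp_conj]
    have h4 : (starRingEnd ℂ) 4 = 4 := map_ofNat _ 4
    simp [neg_div, map_div₀, h4]
  · simp at hk; omega
  · obtain ⟨b, hb⟩ := Int.eq_ofNat_of_zero_le ha.le
    obtain ⟨l, hl⟩ := Int.eq_ofNat_of_zero_le (show 0 ≤ k by nlinarith)
    subst hb hl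
    obtain ⟨C, hC, h⟩ := sum_toCircle_sq_pos b l K (by omega) (by exact_mod_cast hk)
    refine ⟨C, hC, ?_⟩
    rw [Int.sign_eq_one_of_pos ha]
    simpa using h

/-! ### Gauss sums and isotropic subgroups; orthogonal bases of lattices -/

/-- Reduction of Gauss sums along isotropic subgroups. Let `q'` be a quadratic function on `A` that
vanishes on the subgroup `H = ker f`, and identify `D` with `H^⊥ / H` by means of `f` and `j`. Then
the Gauss sum of `q'` over `A` is `|H|` times that of the induced function `q` over `D`: averaging
over translations by `H` kills the terms outside `H^⊥`. -/
theorem sum_toCircle_eq_card_ker_mul {A G D : Type*} [AddCommGroup A] [Fintype A] [AddCommGroup G]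
    [Fintype D] (f : A →+ G) (j : D → G) (hj : Function.Injective j) (hjr : ∀ d, ∃ x, f x = j d)
    (q' : A → UnitAddCircle) (b : A → A →+ UnitAddCircle)
    (hq : ∀ x y, q' (x + y) = q' x + q' y + b x y) (hker : ∀ h, f h = 0 → q' h = 0)
    (hperp : ∀ x, (∀ h, f h = 0 → b x h = 0) → ∃ d, f x = j d)
    (hperp' : ∀ x d, f x = j d → ∀ h, f h = 0 → b x h = 0)
    (q : D → UnitAddCircle) (hqq : ∀ x d, f x = j d → q' x = q d) :
    ∑ x, (AddCircle.toCircle (q' x) : ℂ) =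
      (Nat.card f.ker : ℂ) * ∑ d, (AddCircle.toCircle (q d) : ℂ) := by
  classical
  have : Fintype f.ker := Fintype.ofFinite _
  set S := ∑ x, (AddCircle.toCircle (q' x) : ℂ) with hS
  have h1 : ∀ h : f.ker, S = ∑ x, (AddCircle.toCircle (q' x) : ℂ) *
      (AddCircle.toCircle (b x h) : ℂ) := by
    intro h
    rw [hS, ← Equiv.sum_comp (Equiv.addRight (h : A))
      (fun x => (AddCircle.toCircle (q' x) : ℂ))]
    refine Finset.sum_congr rfl fun x _ => ?_
    rw [Equiv.coe_addRight, hq, hker h h.2, add_zero, AddCircle.toCircle_add, Circle.coe_mul]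
  let χ : A → AddChar f.ker ℂ := fun x =>
    { toFun := fun h => (AddCircle.toCircle (b x h) : ℂ)
      map_zero_eq_one' := by simp
      map_add_eq_mul' := fun h h' => by simp [AddCircle.toCircle_add] }
  have h2 : ∀ x, ∑ h : f.ker, (AddCircle.toCircle (b x h) : ℂ) =
      if ∃ d, f x = j d then (Nat.card f.ker : ℂ) else 0 := by
    intro x
    split_ifs with hx
    · obtain ⟨d, hd⟩ := hx
      simp [hperp' x d hd _ (AddMonoidHom.mem_ker.1 (Subtype.property _))]
    · refine AddChar.sum_eq_zero_of_ne_one (ψ := χ x) fun hχ => hx (hperp x fun h hh => ?_)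
      have := DFunLike.congr_fun hχ ⟨h, hh⟩
      have h3 : (AddCircle.toCircle (b x h) : ℂ) = 1 := this
      refine AddCircle.injective_toCircle one_ne_zero ?_
      rw [AddCircle.toCircle_zero]
      exact Circle.ext h3
  have h4 : (Nat.card f.ker : ℂ) * S = (Nat.card f.ker : ℂ) *
      ∑ x, if ∃ d, f x = j d then (AddCircle.toCircle (q' x) : ℂ) else 0 := by
    calc (Nat.card f.ker : ℂ) * S = ∑ h : f.ker, S := by simp
      _ = ∑ h : f.ker, ∑ x, (AddCircle.toCircle (q' x) : ℂ) *
          (AddCircle.toCircle (b x h) : ℂ) := Finset.sum_congr rfl fun h _ => h1 h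
      _ = _ := by
        rw [Finset.sum_comm, Finset.mul_sum]
        refine Finset.sum_congr rfl fun x _ => ?_
        rw [← Finset.mul_sum, h2]
        split_ifs <;> ring
  have h5 := mul_left_cancel₀ (Nat.cast_ne_zero.2 Nat.card_pos.ne') h4
  rw [h5, Finset.mul_sum]
  have h6 : ∀ x, (if ∃ d, f x = j d then (AddCircle.toCircle (q' x) : ℂ) else 0) =
      ∑ d, if f x = j d then (AddCircle.toCircle (q d) : ℂ) else 0 := by
    intro x
    split_ifs with hx
    · obtain ⟨d, hd⟩ := hx
      rw [Finset.sum_eq_single d]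
      · rw [if_pos hd, hqq x d hd]
      · intro d' _ hd'
        rw [if_neg]
        intro h
        exact hd' (hj (h.symm.trans hd))
      · simp
    · rw [Finset.sum_eq_zero]
      intro d _
      rw [if_neg]
      exact fun h => hx ⟨d, h⟩
  simp only [h6]
  rw [Finset.sum_comm]
  refine Finset.sum_congr rfl fun d _ => ?_
  rw [← Finset.sum_filter, Finset.sum_const, nsmul_eq_mul]
  congr 2
  have := AddMonoidHom.card_fiber_eq_of_mem_range f (x := j d) (y := 0) (hjr d) ⟨0, map_zero f⟩
  rw [this, Nat.card_eq_fintype_card, Fintype.card_subtype]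
  congr 1
  ext x
  simp [AddMonoidHom.mem_ker]

namespace PrimeDisc.EvenLattice

variable {V : Type*} [AddCommGroup V] [Module ℝ V] (L : EvenLattice V)

theorem polar_self (x : V) : QuadraticMap.polar L.Q x x = 2 * L.Q x := by
  rw [QuadraticMap.polar_self]; simp

theorem exists_int_polar {x y : V} (hx : x ∈ L.carrier) (hy : y ∈ L.carrier) :
    ∃ n : ℤ, QuadraticMap.polar L.Q x y = n :=
  L.mem_dual.1 (L.carrier_le_dual hx) y hy

/-- Every even lattice contains an orthogonal `ℝ`-basis of the ambient space: the rational
quadratic space spanned by the lattice can be diagonalised, and denominators can be cleared. -/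
theorem exists_orthogonal_basis : ∃ (n : ℕ) (v : Module.Basis (Fin n) ℝ V) (a : Fin n → ℤ),
    (∀ i, v i ∈ L.carrier) ∧ (∀ i, a i ≠ 0) ∧ (∀ i, L.Q (v i) = a i) ∧
      ∀ i j, i ≠ j → QuadraticMap.polar L.Q (v i) (v j) = 0 := by
  obtain ⟨m, b, hb⟩ := L.isLattice
  have hbL : ∀ i, b i ∈ L.carrier := fun i => by
    rw [hb]; exact Submodule.subset_span ⟨i, rfl⟩
  have hg : ∀ i j, ∃ n : ℤ, QuadraticMap.polar L.Q (b i) (b j) = n :=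
    fun i j => L.exists_int_polar (hbL i) (hbL j)
  choose g hg using hg
  -- the Gram matrix is integral, so the form can be diagonalised over `ℚ`
  let B : LinearMap.BilinForm ℚ (Fin m → ℚ) := Matrix.toBilin' (Matrix.of fun i j => (g i j : ℚ))
  let ι : (Fin m → ℚ) → V := fun x => ∑ i, (x i : ℝ) • b i
  have hB : ∀ x y, QuadraticMap.polar L.Q (ι x) (ι y) = (B x y : ℝ) := by
    intro x y
    have : QuadraticMap.polar L.Q (ι x) (ι y) = QuadraticMap.polarBilin L.Q (ι x) (ι y) := rfl
    rw [this, Matrix.toBilin'_apply]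
    simp only [ι, map_sum, LinearMap.sum_apply, map_smul, LinearMap.smul_apply, smul_eq_mul,
      QuadraticMap.polarBilin_apply_apply, hg]
    push_cast
    rw [Finset.sum_comm]
    refine Finset.sum_congr rfl fun i _ => ?_
    rw [Finset.mul_sum]
    refine Finset.sum_congr rfl fun j _ => ?_
    rw [Matrix.of_apply]
    push_cast
    ring
  have hsymm : LinearMap.IsSymm B := ⟨fun x y => by
    have h1 := hB x y
    have h2 := hB y x
    rw [QuadraticMap.polar_comm, h1] at h2
    simpa using h2⟩
  have hι : ∀ x, ι x = 0 → x = 0 := by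
    intro x hx
    ext i
    have := Fintype.linearIndependent_iff.1 b.linearIndependent (fun i => (x i : ℝ)) hx i
    simpa using this
  have hιs : ∀ i, ι (Pi.single i 1) = b i := by
    intro i
    simp only [ι]
    rw [Finset.sum_eq_single i] <;> simp +contextual
  have hsep : B.SeparatingLeft := by
    intro x hx
    apply hι
    apply L.nondegenerate.1
    intro y
    have h0 : QuadraticMap.polarBilin L.Q (ι x) = 0 := by
      refine b.ext fun j => ?_
      rw [QuadraticMap.polarBilin_apply_apply, ← hιs, hB, hx]
      simp
    rw [h0]; rfl
  obtain ⟨w, hw⟩ := LinearMap.BilinForm.exists_orthogonal_basis hsymm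
  have hw2 := hw.not_isOrtho_basis_self_of_separatingLeft hsep
  -- multiplying by the denominators moves the orthogonal basis into the lattice
  let N : Fin (Module.finrank ℚ (Fin m → ℚ)) → ℕ := fun i => ∏ j, (w i j).den
  have hN : ∀ i, N i ≠ 0 := fun i => Finset.prod_ne_zero_iff.2 fun j _ => (w i j).den_ne_zero
  let v' : Fin (Module.finrank ℚ (Fin m → ℚ)) → V := fun i => ι ((N i : ℚ) • w i)
  have hv'L : ∀ i, v' i ∈ L.carrier := by
    intro i
    refine Submodule.sum_mem _ fun j _ => ?_
    have : ∃ z : ℤ, ((N i : ℚ) • w i) j = z := by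
      refine ⟨(∏ l ∈ Finset.univ.erase j, (w i l).den : ℕ) * (w i j).num, ?_⟩
      have h1 : N i = (w i j).den * ∏ l ∈ Finset.univ.erase j, (w i l).den :=
        (Finset.mul_prod_erase _ _ (Finset.mem_univ j)).symm
      rw [Pi.smul_apply, smul_eq_mul, h1]
      push_cast
      have h2 := Rat.den_mul_eq_num (w i j)
      rw [← h2]
      ring
    obtain ⟨z, hz⟩ := this
    rw [hz]
    simpa [← Int.cast_smul_eq_zsmul ℝ] using L.carrier.smul_mem z (hbL j)
  have ho : ∀ i j, i ≠ j → QuadraticMap.polar L.Q (v' i) (v' j) = 0 := by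
    intro i j hij
    rw [hB]
    have : B (w i) (w j) = 0 := hw hij
    simp [this]
  have hn : ∀ i, L.Q (v' i) ≠ 0 := by
    intro i h0
    have h1 : QuadraticMap.polar L.Q (v' i) (v' i) = 0 := by rw [polar_self, h0, mul_zero]
    rw [hB] at h1
    have h2 : B (w i) (w i) ≠ 0 := hw2 i
    simp [h2, hN i] at h1
  clear_value v'
  have hli : LinearIndependent ℝ v' := by
    rw [Fintype.linearIndependent_iff]
    intro c hc i
    have h1 : QuadraticMap.polarBilin L.Q (∑ j, c j • v' j) (v' i) = 0 := by rw [hc]; simp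
    rw [map_sum, LinearMap.sum_apply, Finset.sum_eq_single i] at h1
    · rw [map_smul, LinearMap.smul_apply, QuadraticMap.polarBilin_apply_apply, polar_self] at h1
      simpa [hn i] using h1
    · intro j _ hj
      simp [ho j i hj]
    · simp
  have hcard : Fintype.card (Fin (Module.finrank ℚ (Fin m → ℚ))) = Module.finrank ℝ V := by
    rw [Module.finrank_eq_card_basis b]; simp
  have ha : ∀ i, ∃ n : ℤ, L.Q (v' i) = n := fun i => L.even _ (hv'L i)
  choose a ha using ha
  have : Module.Finite ℝ V := Module.Finite.of_basis b
  have hsp := hli.span_eq_top_of_card_eq_finrank' hcard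
  refine ⟨_, Module.Basis.mk hli hsp.ge, a, ?_, ?_, ?_, ?_⟩
  · simpa using hv'L
  · intro i h0
    apply hn i
    simp [ha, h0]
  · simpa using ha
  · simpa using ho

/-- The difference `b⁺ - b⁻`, read off from an orthogonal basis. -/
theorem r_eq_sum_sign {n : ℕ} (v : Module.Basis (Fin n) ℝ V) (a : Fin n → ℤ)
    (ha : ∀ i, L.Q (v i) = a i)
    (ho : ∀ i j, i ≠ j → QuadraticMap.polar L.Q (v i) (v j) = 0) :
    L.r = ∑ i, (a i).sign := by
  have hV : Module.Finite ℝ V := Module.Finite.of_basis v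
  have heq : QuadraticMap.Equivalent L.Q
      (QuadraticMap.weightedSumSquares ℝ fun i => (a i : ℝ)) := by
    have h1 : L.Q.basisRepr v = QuadraticMap.weightedSumSquares ℝ fun i => (a i : ℝ) := by
      rw [QuadraticMap.basisRepr_eq_of_iIsOrtho]
      · simp [ha]
      · intro i j hij
        have := ho i j hij
        simp [Function.onFun, QuadraticMap.associated_apply,
          QuadraticMap.polar] at this ⊢
        linarith
    rw [← h1]
    exact ⟨L.Q.isometryEquivBasisRepr v⟩
  have h1 := QuadraticForm.sigPos_of_equiv_weightedSumSquares heq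
  have h2 := QuadraticForm.sigNeg_of_equiv_weightedSumSquares heq
  unfold r
  rw [h1, h2, Set.ncard_eq_toFinset_card', Set.ncard_eq_toFinset_card']
  simp only [Set.toFinset_ofPred, Int.cast_pos, Int.cast_lt_zero, Finset.card_filter]
  push_cast
  rw [← Finset.sum_sub_distrib]
  refine Finset.sum_congr rfl fun i _ => ?_
  rcases lt_trichotomy (a i) 0 with h | h | h
  · simp [h, h.not_gt, Int.sign_eq_neg_one_of_neg h]
  · simp [h]
  · simp [h, h.not_gt, Int.sign_eq_one_of_pos h]

end PrimeDisc.EvenLattice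

/-! ### Milgram's formula -/

theorem toCircle_sum {ι : Type*} (s : Finset ι) (f : ι → UnitAddCircle) :
    (AddCircle.toCircle (∑ i ∈ s, f i) : ℂ) = ∏ i ∈ s, (AddCircle.toCircle (f i) : ℂ) := by
  classical
  induction s using Finset.induction_on with
  | empty => simp
  | insert i s hi ih => rw [Finset.sum_insert hi, Finset.prod_insert hi, AddCircle.toCircle_add,
      Circle.coe_mul, ih]

namespace PrimeDisc.EvenLattice

variable {V : Type*} [AddCommGroup V] [Module ℝ V] (L : EvenLattice V)

theorem intCast_div_toAddCircle {K : ℕ} [NeZero K] (j : ℤ) (x : ℝ) (h : (j : ℝ) = K * x) :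
    (ZMod.toAddCircle (j : ZMod K)) = (x : UnitAddCircle) := by
  rw [ZMod.toAddCircle_intCast, h, mul_div_cancel_left₀]
  exact_mod_cast NeZero.ne K

/-- Milgram's formula, up to a positive factor: the phase of the Gauss sum of the discriminant form
is `e(r / 8)`. The Gauss sum of an orthogonal sublattice is a product of one-dimensional Gauss
sums, and passing from it to `L` divides the sum by the order of an isotropic subgroup. -/
theorem milgram [Fintype L.Disc] : ∃ C : ℝ, 0 < C ∧
    ∑ γ, (AddCircle.toCircle (L.q γ) : ℂ) = C * Complex.exp (Real.pi * Complex.I / 4 * L.r) := by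
  classical
  obtain ⟨n, v, a, hvL, ha0, hva, ho⟩ := L.exists_orthogonal_basis
  set K : ℕ := 4 * ∏ i, (a i).natAbs with hKdef
  have hK0 : K ≠ 0 := by
    simp [hKdef, Finset.prod_ne_zero_iff, ha0]
  have : NeZero K := ⟨hK0⟩
  have hk : ∀ i, ∃ k : ℤ, k * (4 * a i) = K := by
    intro i
    have h1 : a i ∣ ((∏ i, (a i).natAbs : ℕ) : ℤ) := by
      rw [← Int.natAbs_dvd]
      refine Int.natCast_dvd_natCast.2 ?_
      exact Finset.dvd_prod_of_mem _ (Finset.mem_univ i)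
    obtain ⟨k, hk⟩ := h1
    refine ⟨k, ?_⟩
    rw [hKdef]
    push_cast at hk ⊢
    rw [hk]; ring
  choose k hk using hk
  have hkR : ∀ i, (K : ℝ) = k i * (4 * a i) := fun i => by exact_mod_cast (hk i).symm
  have haR : ∀ i, (a i : ℝ) ≠ 0 := fun i => by exact_mod_cast ha0 i
  -- `u` is the basis dual to `v`, so that the lattice `M` spanned by `v` has dual `M' = ⊕ ℤ u i`
  -- and `M ⊆ L ⊆ L' ⊆ M'`; the group `A` surjects onto `M' / M`, with `K` a common period
  let u : Fin n → V := fun i => ((1 : ℝ) / (2 * a i)) • v i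
  let G := V ⧸ L.carrier
  let mk : V →ₗ[ℤ] G := L.carrier.mkQ
  have hmk : ∀ x, mk x = 0 ↔ x ∈ L.carrier := fun x => Submodule.Quotient.mk_eq_zero _
  have hu0 : ∀ i, (zmultiplesHom G (mk (u i))) (K : ℤ) = 0 := by
    intro i
    rw [zmultiplesHom_apply, ← map_zsmul, hmk]
    have : ((K : ℤ)) • u i = (2 * k i : ℤ) • v i := by
      rw [← Int.cast_smul_eq_zsmul ℝ, ← Int.cast_smul_eq_zsmul ℝ, smul_smul]
      congr 1
      push_cast
      rw [hkR i]
      field_simp [haR i]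
      ring
    rw [this]
    exact L.carrier.smul_mem _ (hvL i)
  let A := Fin n → ZMod K
  let f : A →+ G := ∑ i, (ZMod.lift K ⟨zmultiplesHom G (mk (u i)), hu0 i⟩).comp
    (Pi.evalAddMonoidHom _ i)
  let w : (Fin n → ℤ) → V := fun x => ∑ i, (x i : ℝ) • u i
  let red : (Fin n → ℤ) → A := fun x i => (x i : ZMod K)
  have hred : ∀ x : A, ∃ y, red y = x := by
    intro x
    refine ⟨fun i => ((x i).val : ℤ), ?_⟩
    ext i
    simp [red]
  have hf : ∀ x, f (red x) = mk (w x) := by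
    intro x
    simp only [f, red, w, AddMonoidHom.finsetSum_apply, AddMonoidHom.comp_apply, map_sum]
    refine Finset.sum_congr rfl fun i _ => ?_
    rw [Int.cast_smul_eq_zsmul, map_zsmul]
    exact ZMod.lift_coe K ⟨zmultiplesHom G (mk (u i)), hu0 i⟩ (x i)
  have hpol : ∀ (x : V) (i : Fin n) (c : Fin n → ℝ), x = ∑ j, c j • v j →
      QuadraticMap.polar L.Q x (v i) = 2 * a i * c i := by
    intro x i c hx
    rw [hx, ← QuadraticMap.polarBilin_apply_apply, map_sum, LinearMap.sum_apply,
      Finset.sum_eq_single i]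
    · rw [map_smul, LinearMap.smul_apply, QuadraticMap.polarBilin_apply_apply, polar_self, hva,
        smul_eq_mul]
      ring
    · intro j _ hj
      simp [ho j i hj]
    · simp
  have hwv : ∀ x, w x = ∑ i, ((x i : ℝ) / (2 * a i)) • v i := by
    intro x
    refine Finset.sum_congr rfl fun i _ => ?_
    simp only [u, smul_smul]
    congr 1; ring
  have hpolw : ∀ x y, QuadraticMap.polar L.Q (w x) (w y) =
      ∑ i, (x i * y i : ℝ) / (2 * a i) := by
    intro x y
    conv_lhs => rw [hwv y]
    rw [← QuadraticMap.polarBilin_apply_apply, map_sum]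
    refine Finset.sum_congr rfl fun i _ => ?_
    rw [map_smul, QuadraticMap.polarBilin_apply_apply, hpol _ i _ (hwv x), smul_eq_mul]
    field_simp [haR i]
  have hQw : ∀ x, L.Q (w x) = ∑ i, (x i : ℝ) ^ 2 / (4 * a i) := by
    intro x
    have h1 := L.polar_self (w x)
    rw [hpolw] at h1
    have h2 : ∑ i, (x i * x i : ℝ) / (2 * a i) = 2 * ∑ i, (x i : ℝ) ^ 2 / (4 * a i) := by
      rw [Finset.mul_sum]
      refine Finset.sum_congr rfl fun i _ => ?_
      field_simp [haR i]
      ring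
    linarith
  -- every vector pairing integrally with the `v i`, in particular every vector of `L` and of `L'`,
  -- is an integral combination of the `u i`
  have hrep : ∀ x : V, (∀ i, ∃ z : ℤ, QuadraticMap.polar L.Q x (v i) = z) → ∃ y, w y = x := by
    intro x hx
    choose z hz using hx
    refine ⟨z, ?_⟩
    have h1 : x = ∑ i, v.repr x i • v i := (v.sum_repr x).symm
    rw [hwv]
    conv_rhs => rw [h1]
    refine Finset.sum_congr rfl fun i _ => ?_
    rw [← hz i, hpol x i _ h1]
    congr 1
    field_simp [haR i]
  let q' : A → UnitAddCircle := fun x => ∑ i, ZMod.toAddCircle ((k i : ZMod K) * x i ^ 2)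
  let b : A → A →+ UnitAddCircle := fun x => ∑ i, (ZMod.toAddCircle.comp
    ((AddMonoidHom.mulLeft ((2 * k i : ZMod K) * x i)).comp (Pi.evalAddMonoidHom _ i)))
  have hb : ∀ x y, b x y = ∑ i, ZMod.toAddCircle ((2 * k i : ZMod K) * x i * y i) := by
    intro x y
    simp only [b, AddMonoidHom.finsetSum_apply]
    rfl
  have coe_sum : ∀ g : Fin n → ℝ, ((∑ i, g i : ℝ) : UnitAddCircle) =
      ∑ i, (g i : UnitAddCircle) := fun g => map_sum (QuotientAddGroup.mk' _) g _
  have hq'w : ∀ x, q' (red x) = (L.Q (w x) : UnitAddCircle) := by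
    intro x
    rw [hQw, coe_sum]
    refine Finset.sum_congr rfl fun i _ => ?_
    rw [← intCast_div_toAddCircle (K := K) (k i * x i ^ 2)]
    · simp [red]
    · rw [hkR i]; push_cast; field_simp [haR i]
  have hbw : ∀ x y, b (red x) (red y) =
      ((QuadraticMap.polar L.Q (w x) (w y) : ℝ) : UnitAddCircle) := by
    intro x y
    rw [hpolw, coe_sum, hb]
    refine Finset.sum_congr rfl fun i _ => ?_
    rw [← intCast_div_toAddCircle (K := K) (2 * k i * x i * y i)]
    · simp [red]
    · rw [hkR i]; push_cast; field_simp [haR i]; ring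
  have hint : ∀ x : ℝ, (x : UnitAddCircle) = 0 ↔ ∃ z : ℤ, x = z := by
    intro x
    rw [AddCircle.coe_eq_zero_iff]
    simp [eq_comm]
  let j : L.Disc → G := Submodule.mapQ _ _ L.dual.subtype (by
    rw [Submodule.submoduleOf])
  have hj : ∀ x : L.dual, j (Submodule.Quotient.mk x) = mk (x : V) := fun x => rfl
  have hmem : ∀ x : V, x ∈ L.dual → ∃ y, w y = x := fun x hx =>
    hrep x fun i => L.mem_dual.1 hx _ (hvL i)
  have main := sum_toCircle_eq_card_ker_mul f j ?_ ?_ q' b ?_ ?_ ?_ ?_ L.q ?_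
  · have hprod : ∑ x, (AddCircle.toCircle (q' x) : ℂ) = ∏ i, ∑ x : ZMod K,
        (AddCircle.toCircle (ZMod.toAddCircle ((k i : ZMod K) * x ^ 2)) : ℂ) := by
      rw [Fintype.prod_sum]
      exact Finset.sum_congr rfl fun x _ => toCircle_sum _ _
    have hg : ∀ i, ∃ C : ℝ, 0 < C ∧ _ := fun i => sum_toCircle_sq (a i) (k i) K (hk i)
    choose C hC hg using hg
    simp only [hg] at hprod
    rw [Finset.prod_mul_distrib, ← Complex.exp_sum, ← Finset.mul_sum] at hprod
    have hker : (0 : ℝ) < Nat.card f.ker := by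
      exact_mod_cast Nat.card_pos
    have hr : (L.r : ℂ) = ∑ i, ((a i).sign : ℂ) := by
      rw [L.r_eq_sum_sign v a hva ho]; push_cast; rfl
    refine ⟨(∏ i, C i) / Nat.card f.ker, div_pos (Finset.prod_pos fun i _ => hC i) hker, ?_⟩
    rw [hprod] at main
    rw [hr]
    push_cast
    rw [div_mul_eq_mul_div, main, mul_div_cancel_left₀]
    exact_mod_cast hker.ne'
  · intro d d' hd
    obtain ⟨x, rfl⟩ := Submodule.Quotient.mk_surjective _ d
    obtain ⟨x', rfl⟩ := Submodule.Quotient.mk_surjective _ d'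
    rw [hj, hj, ← sub_eq_zero, ← map_sub, hmk] at hd
    exact (Submodule.Quotient.eq _).2 hd
  · intro d
    obtain ⟨x, rfl⟩ := Submodule.Quotient.mk_surjective _ d
    obtain ⟨y, hy⟩ := hmem x x.2
    exact ⟨red y, by rw [hf, hy, hj]⟩
  · intro x y
    rw [hb]
    simp only [q', ← Finset.sum_add_distrib, ← map_add]
    refine Finset.sum_congr rfl fun i _ => ?_
    congr 1
    change (k i : ZMod K) * (x i + y i) ^ 2 = _
    ring
  · intro x hx
    obtain ⟨y, rfl⟩ := hred x
    rw [hf, hmk] at hx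
    rw [hq'w, hint]
    exact L.even _ hx
  · intro x hx
    obtain ⟨y, rfl⟩ := hred x
    refine ⟨Submodule.Quotient.mk ⟨w y, L.mem_dual.2 fun z hz => ?_⟩, by rw [hf, hj]⟩
    obtain ⟨z', rfl⟩ := hmem z (L.carrier_le_dual hz)
    rw [← hint, ← hbw]
    exact hx _ (by rw [hf, hmk]; exact hz)
  · intro x d hd h hh
    obtain ⟨y, rfl⟩ := hred x
    obtain ⟨y', rfl⟩ := hred h
    obtain ⟨x, rfl⟩ := Submodule.Quotient.mk_surjective _ d
    rw [hf, hj, ← sub_eq_zero, ← map_sub, hmk] at hd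
    rw [hf, hmk] at hh
    have hdual : w y ∈ L.dual := by
      have := L.dual.add_mem (L.carrier_le_dual hd) x.2
      simpa using this
    rw [hbw, hint]
    exact L.mem_dual.1 hdual _ hh
  · intro x d hd
    obtain ⟨y, rfl⟩ := hred x
    obtain ⟨x, rfl⟩ := Submodule.Quotient.mk_surjective _ d
    rw [hf, hj, ← sub_eq_zero, ← map_sub, hmk] at hd
    have hdual : w y ∈ L.dual := by
      have := L.dual.add_mem (L.carrier_le_dual hd) x.2
      simpa using this
    rw [hq'w, ← L.q_mk ⟨w y, hdual⟩]
    congr 1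
    exact (Submodule.Quotient.eq _).2 hd

end PrimeDisc.EvenLattice

/-! ### The discriminant form for odd prime discriminant, and Gauss sums over `𝔽_p` -/

namespace PrimeDisc.EvenLattice

variable {V : Type*} [AddCommGroup V] [Module ℝ V] (L : EvenLattice V)

/-- If the discriminant form is zero then `L' ⊆ L'' = L`. -/
theorem bil_eq_zero_imp (h : ∀ γ δ : L.Disc, L.bil γ δ = 0) : L.dual ≤ L.carrier := by
  obtain ⟨m, b, hb⟩ := L.isLattice
  have hsymm : LinearMap.BilinForm.IsSymm (QuadraticMap.polarBilin L.Q) :=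
    ⟨fun x y => by simp [QuadraticMap.polar_comm]⟩
  have h1 := LinearMap.BilinForm.dualSubmodule_dualSubmodule_of_basis (R := ℤ)
    (QuadraticMap.polarBilin L.Q) L.nondegenerate hsymm b
  rw [← hb] at h1
  intro x hx
  rw [← h1]
  intro y hy
  have h2 := h (Submodule.Quotient.mk ⟨x, hx⟩) (Submodule.Quotient.mk ⟨y, hy⟩)
  rw [bil_mk, AddCircle.coe_eq_zero_iff] at h2
  obtain ⟨n, hn⟩ := h2
  rw [Submodule.mem_one]
  refine ⟨n, ?_⟩
  simpa using hn

theorem q_zsmul (n : ℤ) (γ : L.Disc) : L.q (n • γ) = (n ^ 2) • L.q γ := by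
  obtain ⟨x, rfl⟩ := Submodule.Quotient.mk_surjective _ γ
  rw [← Submodule.Quotient.mk_smul, q_mk, q_mk, ← AddCircle.coe_zsmul]
  congr 1
  have : ((n • x : L.dual) : V) = (n : ℝ) • (x : V) := by
    rw [Int.cast_smul_eq_zsmul]; rfl
  rw [this, QuadraticMap.map_smul]
  simp [sq]

/-- On a discriminant group killed by the odd number `p`, the quadratic form takes values in
`p⁻¹ℤ / ℤ`. -/
theorem exists_q_eq_toAddCircle (p : ℕ) [NeZero p] (hp : Odd p) (γ : L.Disc)
    (hγ : (p : ℤ) • γ = 0) : ∃ α : ZMod p, L.q γ = ZMod.toAddCircle α := by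
  obtain ⟨x, rfl⟩ := Submodule.Quotient.mk_surjective _ γ
  rw [← Submodule.Quotient.mk_smul, Submodule.Quotient.mk_eq_zero] at hγ
  have hx : ((p : ℝ) • (x : V)) ∈ L.carrier := by
    have : (((p : ℤ) • x : L.dual) : V) ∈ L.carrier := hγ
    have h2 : (((p : ℤ) • x : L.dual) : V) = (p : ℝ) • (x : V) := by
      rw [← Int.cast_natCast (R := ℝ), Int.cast_smul_eq_zsmul]; rfl
    rwa [h2] at this
  obtain ⟨z, hz⟩ := L.mem_dual.1 x.2 _ hx
  obtain ⟨z', hz'⟩ := L.even _ hx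
  rw [QuadraticMap.map_smul] at hz'
  rw [QuadraticMap.polar_smul_right, polar_self] at hz
  obtain ⟨m, hm⟩ := hp
  have hpR : (p : ℝ) = 2 * m + 1 := by rw [hm]; push_cast; ring
  have hp0 : (p : ℝ) ≠ 0 := by exact_mod_cast NeZero.ne p
  -- with `p = 2m + 1` and `(x, px) = z`, `Q(px) = z'`, one has `p Q(x) = z' - m z`
  refine ⟨((z' - m * z : ℤ) : ZMod p), ?_⟩
  rw [q_mk, intCast_div_toAddCircle (x := L.Q (x : V))]
  push_cast
  rw [← hz, ← hz', smul_eq_mul, smul_eq_mul, hpR]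
  ring

theorem exists_discIso (p : ℕ) [Fact p.Prime] (hp : p ≠ 2) (hL : Nat.card L.Disc = p) :
    ∃ (φ : L.Disc ≃+ ZMod p) (α : ZMod p), L.IsDiscIso p φ α := by
  have hodd : Odd p := (Fact.out : p.Prime).odd_of_ne_two hp
  have hcyc : IsAddCyclic L.Disc := isAddCyclic_of_prime_card hL
  let φ : L.Disc ≃+ ZMod p := (hL ▸ zmodAddCyclicAddEquiv hcyc : ZMod p ≃+ L.Disc).symm
  have hkill : ∀ γ : L.Disc, (p : ℤ) • γ = 0 := by
    intro γ
    apply φ.injective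
    rw [map_zsmul, map_zero]
    simp
  obtain ⟨α, hα⟩ := L.exists_q_eq_toAddCircle p hodd (φ.symm 1) (hkill _)
  have hq : ∀ γ, L.q γ = ZMod.toAddCircle (α * φ γ ^ 2) := by
    intro γ
    obtain ⟨n, hn⟩ : ∃ n : ℤ, φ γ = n := ⟨(φ γ).cast, by simp⟩
    have : γ = n • φ.symm 1 := by
      apply φ.injective
      rw [map_zsmul, φ.apply_symm_apply, hn]
      simp
    rw [hn]
    conv_lhs => rw [this]
    rw [q_zsmul, hα, ← map_zsmul]
    congr 1
    simp [mul_comm]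
  refine ⟨φ, α, ?_, hq⟩
  rintro rfl
  have hle : L.dual ≤ L.carrier := L.bil_eq_zero_imp fun γ δ => by
    simp [bil, QuadraticMap.polar, hq]
  have hsub : Subsingleton L.Disc := by
    rw [Submodule.Quotient.subsingleton_iff, Submodule.submoduleOf_eq_top]
    exact hle
  have : Nat.card L.Disc = 1 := Nat.card_of_subsingleton 0
  exact (Fact.out : p.Prime).one_lt.ne' (hL.symm.trans this)

/-- Another identification of the discriminant group with `𝔽_p` changes `α` by a square. -/
theorem IsDiscIso.quadraticChar_eq {p : ℕ} [Fact p.Prime] {φ : L.Disc ≃+ ZMod p} {α : ZMod p}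
    (h : L.IsDiscIso p φ α) : quadraticChar (ZMod p) α = L.discSign p := by
  classical
  unfold discSign
  split_ifs with hsq
  · obtain ⟨φ', α', h', hs⟩ := hsq
    rw [quadraticChar_one_iff_isSquare h.1]
    have h1 := h.2 (φ.symm 1)
    rw [h'.2 (φ.symm 1), ZMod.toAddCircle_inj, φ.apply_symm_apply] at h1
    obtain ⟨s, rfl⟩ := hs
    exact ⟨s * φ' (φ.symm 1), by
      rw [one_pow, mul_one] at h1
      rw [← h1]; ring⟩
  · rw [quadraticChar_neg_one_iff_not_isSquare]
    exact fun hs => hsq ⟨φ, α, h, hs⟩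

theorem IsDiscIso.bil_eq {p : ℕ} [Fact p.Prime] {φ : L.Disc ≃+ ZMod p} {α : ZMod p}
    (h : L.IsDiscIso p φ α) (γ δ : L.Disc) :
    L.bil γ δ = ZMod.toAddCircle (2 * α * φ γ * φ δ) := by
  rw [bil, QuadraticMap.polar, h.2, h.2, h.2, ← map_sub, ← map_sub, map_add]
  congr 1
  ring

end PrimeDisc.EvenLattice

section GaussSum

variable {p : ℕ} [Fact p.Prime]

open ZMod

theorem toCircle_toAddCircle (x : ZMod p) :
    (AddCircle.toCircle (ZMod.toAddCircle x) : ℂ) = stdAddChar x := rfl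

/-- The quadratic character of `𝔽_p` with complex values. -/
noncomputable def quadCharC (p : ℕ) [Fact p.Prime] : MulChar (ZMod p) ℂ :=
  (quadraticChar (ZMod p)).ringHomComp (Int.castRingHom ℂ)

theorem quadCharC_apply (x : ZMod p) : quadCharC p x = (quadraticChar (ZMod p) x : ℂ) := rfl

theorem quadCharC_sq {x : ZMod p} (hx : x ≠ 0) : quadCharC p x * quadCharC p x = 1 := by
  rw [quadCharC_apply]
  exact_mod_cast (sq (quadraticChar (ZMod p) x)).symm.trans (quadraticChar_sq_one hx)

theorem quadCharC_inv (x : ZMod p) : quadCharC p x⁻¹ = quadCharC p x := by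
  by_cases hx : x = 0
  · simp [hx]
  · refine mul_left_cancel₀ (a := quadCharC p x) (fun h => ?_) ?_
    · simpa [h] using quadCharC_sq hx
    · rw [← map_mul, mul_inv_cancel₀ hx, map_one, quadCharC_sq hx]

/-- The quadratic Gauss sum `∑ e(x / p)`, weighted by the Legendre symbol. -/
noncomputable def quadGauss (p : ℕ) [Fact p.Prime] : ℂ :=
  gaussSum (quadCharC p) (stdAddChar (N := p))

theorem ringChar_zmod_ne_two (hp : p ≠ 2) : ringChar (ZMod p) ≠ 2 := by
  rwa [ZMod.ringChar_zmod_n]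

theorem quadCharC_ne_one (hp : p ≠ 2) : quadCharC p ≠ 1 := by
  intro h
  obtain ⟨a, ha⟩ := quadraticChar_exists_neg_one' (ringChar_zmod_ne_two hp)
  have h1 := DFunLike.congr_fun h (a : ZMod p)
  rw [quadCharC_apply, ha, MulChar.one_apply_coe] at h1
  norm_num at h1

theorem quadGauss_sq (hp : p ≠ 2) : quadGauss p ^ 2 = quadCharC p (-1) * p := by
  have := gaussSum_sq (quadCharC_ne_one hp) ((quadraticChar_isQuadratic _).comp _)
    (isPrimitive_stdAddChar p)
  rw [ZMod.card] at this
  exact this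

theorem sum_stdAddChar_mul (t : ZMod p) :
    ∑ y : ZMod p, (stdAddChar (t * y) : ℂ) = if t = 0 then (p : ℂ) else 0 := by
  have := AddChar.sum_mulShift t (isPrimitive_stdAddChar p)
  simp only [ZMod.card] at this
  simp only [mul_comm t]
  rw [this]; split_ifs <;> simp

theorem sum_stdAddChar_mul_sq (hp : p ≠ 2) {t : ZMod p} (ht : t ≠ 0) :
    ∑ x : ZMod p, (stdAddChar (t * x ^ 2) : ℂ) = quadCharC p t * quadGauss p := by
  classical
  have h1 : ∑ x : ZMod p, (stdAddChar (t * x ^ 2) : ℂ) =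
      ∑ y : ZMod p, (quadCharC p y + 1) * stdAddChar (t * y) := by
    rw [← Finset.sum_fiberwise (s := Finset.univ) (g := fun x : ZMod p => x ^ 2)]
    refine Finset.sum_congr rfl fun y _ => ?_
    have h2 := quadraticChar_card_sqrts (ringChar_zmod_ne_two hp) y
    have h3 : ∀ x ∈ Finset.univ.filter (fun x : ZMod p => x ^ 2 = y),
        (stdAddChar (t * x ^ 2) : ℂ) = stdAddChar (t * y) := by
      intro x hx
      rw [(Finset.mem_filter.1 hx).2]
    rw [Finset.sum_congr rfl h3, Finset.sum_const, nsmul_eq_mul, quadCharC_apply]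
    congr 1
    have h4 : (Set.toFinset {x : ZMod p | x ^ 2 = y}) =
        Finset.univ.filter (fun x => x ^ 2 = y) := by
      ext; simp
    rw [h4] at h2
    exact_mod_cast h2
  simp only [add_mul, one_mul, Finset.sum_add_distrib, sum_stdAddChar_mul, if_neg ht, add_zero]
    at h1
  rw [h1]
  have h5 := gaussSum_mulShift (quadCharC p) (stdAddChar (N := p)) (Units.mk0 t ht)
  rw [quadGauss, ← h5, Units.val_mk0, ← mul_assoc, quadCharC_sq ht, one_mul]
  rfl

end GaussSum

/-! ### Operators of the Weil representation on functions on `𝔽_p` -/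

section WeilOp

open ZMod

variable {p : ℕ} [Fact p.Prime]

/-- The operator on functions on `𝔽_p` by which the matrix with rows `(a, b)`, `(c, d)` acts in the
Weil representation attached to the quadratic form `α x² / p`; `κ` is the normalising constant in
the action of `S`. For `c ≠ 0` it is an integral operator with Gaussian kernel, for `c = 0` a
substitution; the entries need only be known modulo `p`. -/
noncomputable def weilOp (α : ZMod p) (κ : ℂ) (a b c d : ZMod p) :
    (ZMod p → ℂ) →ₗ[ℂ] (ZMod p → ℂ) where
  toFun v x := if c = 0 then quadCharC p a * stdAddChar (α * (a * b * x ^ 2)) * v (a * x)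
    else quadCharC p c * κ *
      ∑ y, stdAddChar (α * ((a * x ^ 2 - 2 * x * y + d * y ^ 2) / c)) * v y
  map_add' v w := by
    ext x
    simp only [Pi.add_apply]
    split_ifs
    · ring
    · simp only [mul_add, Finset.sum_add_distrib]
  map_smul' t v := by
    ext x
    simp only [Pi.smul_apply, smul_eq_mul, RingHom.id_apply]
    split_ifs
    · ring
    · simp only [mul_left_comm _ t, ← Finset.mul_sum]

variable {α : ZMod p} {κ : ℂ}

theorem weilOp_apply_of_eq_zero (a b d : ZMod p) (v : ZMod p → ℂ) (x : ZMod p) :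
    weilOp α κ a b 0 d v x = quadCharC p a * stdAddChar (α * (a * b * x ^ 2)) * v (a * x) := by
  simp [weilOp]

theorem weilOp_apply_of_ne_zero (a b : ZMod p) {c : ZMod p} (hc : c ≠ 0) (d : ZMod p)
    (v : ZMod p → ℂ) (x : ZMod p) :
    weilOp α κ a b c d v x = quadCharC p c * κ *
      ∑ y, stdAddChar (α * ((a * x ^ 2 - 2 * x * y + d * y ^ 2) / c)) * v y := by
  simp [weilOp, hc]

theorem weilOp_T (v : ZMod p → ℂ) (x : ZMod p) :
    weilOp α κ 1 1 0 1 v x = stdAddChar (α * x ^ 2) * v x := by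
  simp [weilOp_apply_of_eq_zero]

theorem weilOp_S (v : ZMod p → ℂ) (x : ZMod p) :
    weilOp α κ 0 (-1) 1 0 v x = κ * ∑ y, stdAddChar (-(2 * α * x * y)) * v y := by
  rw [weilOp_apply_of_ne_zero _ _ one_ne_zero, map_one, one_mul]
  congr 1
  refine Finset.sum_congr rfl fun y _ => ?_
  congr 2
  ring

theorem weilOp_one : weilOp α κ 1 0 0 1 = LinearMap.id := by
  ext v x
  simp [weilOp_apply_of_eq_zero]

theorem weilOp_mul_T (a b c d : ZMod p) (v : ZMod p → ℂ) :
    weilOp α κ a b c d (weilOp α κ 1 1 0 1 v) = weilOp α κ a (a + b) c (c + d) v := by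
  ext x
  by_cases hc : c = 0
  · subst hc
    simp only [weilOp_apply_of_eq_zero, map_one, one_mul, mul_one]
    rw [mul_assoc, mul_assoc, ← mul_assoc (stdAddChar _) (stdAddChar _), ← AddChar.map_add_eq_mul,
      mul_assoc]
    congr 3
    ring
  · rw [weilOp_apply_of_ne_zero _ _ hc, weilOp_apply_of_ne_zero _ _ hc]
    congr 1
    refine Finset.sum_congr rfl fun y _ => ?_
    rw [weilOp_T, ← mul_assoc, ← AddChar.map_add_eq_mul]
    congr 2
    field_simp
    ring

/-- Completing the square in a quadratic exponential sum over `𝔽_p`. -/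
theorem sum_stdAddChar_quadratic (hp : p ≠ 2) {t : ZMod p} (ht : t ≠ 0) (s : ZMod p) :
    ∑ x : ZMod p, (stdAddChar (t * (x ^ 2 + 2 * s * x)) : ℂ) =
      stdAddChar (-(t * s ^ 2)) * (quadCharC p t * quadGauss p) := by
  rw [← sum_stdAddChar_mul_sq hp ht, ← Equiv.sum_comp (Equiv.addRight s) (fun x : ZMod p =>
    (stdAddChar (t * x ^ 2) : ℂ)), Finset.mul_sum]
  refine Finset.sum_congr rfl fun x _ => ?_
  rw [← AddChar.map_add_eq_mul, Equiv.coe_addRight]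
  congr 1
  ring

/-- Right multiplication by `S`. If both lower entries are non-zero, then the sum over the
intermediate variable is a quadratic Gauss sum, which cancels one factor `κ`. -/
theorem weilOp_mul_S (hp : p ≠ 2) (hα : α ≠ 0) (hκ : κ * (quadCharC p α * quadGauss p) = 1)
    (a b c d : ZMod p) (h : a * d - b * c = 1) (v : ZMod p → ℂ) :
    weilOp α κ a b c d (weilOp α κ 0 (-1) 1 0 v) = weilOp α κ b (-a) d (-c) v := by
  have h2 : (2 : ZMod p) ≠ 0 := by
    have := Ring.two_ne_zero (ringChar_zmod_ne_two hp)
    exact this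
  have hκ2 : κ * κ * p = quadCharC p (-1) := by
    have h1 := quadGauss_sq hp
    have h3 : (κ * (quadCharC p α * quadGauss p)) ^ 2 = 1 := by rw [hκ, one_pow]
    have h4 : quadCharC p (-1) * quadCharC p (-1) = 1 := quadCharC_sq (by simp)
    have h5 := quadCharC_sq hα
    rw [mul_pow, mul_pow, h1, sq (quadCharC p α), h5] at h3
    linear_combination quadCharC p (-1) * h3 - κ * κ * p * h4
  ext x
  by_cases hc : c = 0
  · subst hc
    have had : a * d = 1 := by simpa using h
    have hd : d ≠ 0 := by rintro rfl; simp at had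
    have ha : a = d⁻¹ := eq_inv_of_mul_eq_one_left had
    rw [weilOp_apply_of_eq_zero, weilOp_S, weilOp_apply_of_ne_zero _ _ hd, ha, quadCharC_inv,
      Finset.mul_sum, Finset.mul_sum, Finset.mul_sum]
    refine Finset.sum_congr rfl fun y _ => ?_
    have : (stdAddChar (α * ((b * x ^ 2 - 2 * x * y + -0 * y ^ 2) / d)) : ℂ) =
        stdAddChar (α * (d⁻¹ * b * x ^ 2)) * stdAddChar (-(2 * α * (d⁻¹ * x) * y)) := by
      rw [← AddChar.map_add_eq_mul]
      congr 1
      field_simp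
      ring
    rw [this]; ring
  · rw [weilOp_apply_of_ne_zero _ _ hc]
    simp only [weilOp_S]
    have hswap : quadCharC p c * κ *
          ∑ y, stdAddChar (α * ((a * x ^ 2 - 2 * x * y + d * y ^ 2) / c)) *
          (κ * ∑ z, stdAddChar (-(2 * α * y * z)) * v z) =
        quadCharC p c * κ * κ * ∑ z, (∑ y, stdAddChar (α * ((a * x ^ 2 - 2 * x * y + d * y ^ 2) / c)
          - 2 * α * y * z)) * v z := by
      simp only [Finset.mul_sum, Finset.sum_mul]
      rw [Finset.sum_comm]
      refine Finset.sum_congr rfl fun z _ => Finset.sum_congr rfl fun y _ => ?_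
      rw [show α * ((a * x ^ 2 - 2 * x * y + d * y ^ 2) / c) - 2 * α * y * z = _ + _ from
        sub_eq_add_neg _ _, AddChar.map_add_eq_mul]
      ring
    rw [hswap]
    by_cases hd : d = 0
    · subst hd
      have hbc : b * c = -1 := by linear_combination -h
      have hb : b ≠ 0 := by rintro rfl; simp at hbc
      have hcb : c = (-1) * b⁻¹ := by field_simp; linear_combination hbc
      rw [weilOp_apply_of_eq_zero]
      have hin : ∀ z, ∑ y, (stdAddChar (α * ((a * x ^ 2 - 2 * x * y + 0 * y ^ 2) / c)
          - 2 * α * y * z) : ℂ) = stdAddChar (α * (b * -a * x ^ 2)) *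
            if z = b * x then (p : ℂ) else 0 := by
        intro z
        have : (if z = b * x then (p : ℂ) else 0) =
            if 2 * α * (b * x - z) = 0 then (p : ℂ) else 0 := by
          congr 1
          rw [mul_eq_zero, or_iff_right (mul_ne_zero h2 hα), sub_eq_zero]
          exact propext eq_comm
        rw [this, ← sum_stdAddChar_mul, Finset.mul_sum]
        refine Finset.sum_congr rfl fun y _ => ?_
        rw [← AddChar.map_add_eq_mul]
        congr 1
        rw [hcb]
        field_simp
        ring
      simp only [hin]
      simp only [mul_assoc, ite_mul, zero_mul, mul_ite, mul_zero, Finset.sum_ite_eq',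
        Finset.mem_univ, if_true]
      have h6 : quadCharC p c = quadCharC p (-1) * quadCharC p b := by
        rw [hcb, map_mul, quadCharC_inv]
      have h4 : quadCharC p (-1) * quadCharC p (-1) = 1 := quadCharC_sq (by simp)
      rw [h6]
      linear_combination (quadCharC p (-1) * quadCharC p b *
        stdAddChar (α * (b * (-a * x ^ 2))) * v (b * x)) * hκ2 + (quadCharC p b *
        stdAddChar (α * (b * (-a * x ^ 2))) * v (b * x)) * h4
    · rw [weilOp_apply_of_ne_zero _ _ hd, Finset.mul_sum, Finset.mul_sum]
      refine Finset.sum_congr rfl fun z _ => ?_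
      have h7 := sum_stdAddChar_quadratic hp (t := α * d / c)
        (div_ne_zero (mul_ne_zero hα hd) hc) (-(x + c * z) / d)
      have h8 : ∀ y,
          (stdAddChar (α * ((a * x ^ 2 - 2 * x * y + d * y ^ 2) / c) - 2 * α * y * z) : ℂ)
          = stdAddChar (α * (a * x ^ 2 / c)) *
            stdAddChar (α * d / c * (y ^ 2 + 2 * (-(x + c * z) / d) * y)) := by
        intro y
        rw [← AddChar.map_add_eq_mul]
        congr 1
        field_simp
        ring
      simp only [h8]
      rw [← Finset.mul_sum, h7, ← mul_assoc (stdAddChar _) (stdAddChar _), ← AddChar.map_add_eq_mul]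
      have h9 : α * (a * x ^ 2 / c) + -(α * d / c * (-(x + c * z) / d) ^ 2) =
          α * ((b * x ^ 2 - 2 * x * z + -c * z ^ 2) / d) := by
        field_simp
        linear_combination x ^ 2 * h
      have h11 : quadCharC p (α * d / c) = quadCharC p α * quadCharC p d * quadCharC p c := by
        rw [div_eq_mul_inv, map_mul, map_mul, quadCharC_inv]
      rw [h9, h11]
      have h10 := quadCharC_sq hc
      set E : ℂ := stdAddChar (α * ((b * x ^ 2 - 2 * x * z + -c * z ^ 2) / d))
      linear_combination (E * v z * quadCharC p d * κ) *
        ((quadCharC p c * quadCharC p c) * hκ + h10)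

end WeilOp

/-! ### The Weil representation of the lattice -/

section WeilRepresentation

open ZMod

variable {p : ℕ} [Fact p.Prime] {α : ZMod p} {κ : ℂ}

/-- The action of an element of `SL₂(ℤ)` on functions on `𝔽_p`, through its reduction modulo `p`. -/
noncomputable def weilOpSL (α : ZMod p) (κ : ℂ) (g : SL(2, ℤ)) : (ZMod p → ℂ) →ₗ[ℂ] (ZMod p → ℂ) :=
  weilOp α κ (g 0 0 : ℤ) (g 0 1 : ℤ) (g 1 0 : ℤ) (g 1 1 : ℤ)

theorem weilOpSL_one : weilOpSL α κ 1 = LinearMap.id := by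
  simp [weilOpSL, weilOp_one]

theorem weilOpSL_T : weilOpSL α κ ModularGroup.T = weilOp α κ 1 1 0 1 := by
  simp [weilOpSL, ModularGroup.T]

theorem weilOpSL_S : weilOpSL α κ ModularGroup.S = weilOp α κ 0 (-1) 1 0 := by
  simp [weilOpSL, ModularGroup.S]

theorem det_cast_eq_one (p : ℕ) (g : SL(2, ℤ)) :
    ((g 0 0 : ℤ) : ZMod p) * ((g 1 1 : ℤ) : ZMod p) -
      ((g 0 1 : ℤ) : ZMod p) * ((g 1 0 : ℤ) : ZMod p)
      = 1 := by
  have := g.det_coe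
  rw [Matrix.det_fin_two] at this
  exact_mod_cast congrArg (Int.cast : ℤ → ZMod p) this

/-- The operators compose correctly: this holds for right multiplication by the generators `T` and
`S`, hence by every element. -/
theorem weilOpSL_mul (hp : p ≠ 2) (hα : α ≠ 0) (hκ : κ * (quadCharC p α * quadGauss p) = 1)
    (g h : SL(2, ℤ)) : weilOpSL α κ (g * h) = weilOpSL α κ g ∘ₗ weilOpSL α κ h := by
  have hh : h ∈ Subgroup.closure {ModularGroup.S, ModularGroup.T} := by
    rw [SpecialLinearGroup.SL2Z_generators]; trivial
  induction hh using Subgroup.closure_induction generalizing g with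
  | mem x hx =>
    rcases hx with rfl | rfl
    · refine LinearMap.ext fun v => ?_
      rw [weilOpSL_S, LinearMap.comp_apply, weilOpSL.eq_1 α κ g,
        weilOp_mul_S hp hα hκ _ _ _ _ (det_cast_eq_one p g), weilOpSL]
      congr 2 <;> simp [ModularGroup.coe_S, Matrix.mul_apply, Fin.sum_univ_two]
    · refine LinearMap.ext fun v => ?_
      rw [weilOpSL_T, LinearMap.comp_apply, weilOpSL.eq_1 α κ g, weilOp_mul_T, weilOpSL]
      congr 2 <;> simp [ModularGroup.coe_T, Matrix.mul_apply, Fin.sum_univ_two]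
  | one => rw [mul_one, weilOpSL_one, LinearMap.comp_id]
  | mul x y _ _ hx hy => rw [← mul_assoc, hy, hx, hy x, LinearMap.comp_assoc]
  | inv x _ hx =>
    have h1 : weilOpSL α κ x⁻¹ ∘ₗ weilOpSL α κ x = LinearMap.id := by
      rw [← hx, inv_mul_cancel, weilOpSL_one]
    have h2 : weilOpSL α κ x ∘ₗ weilOpSL α κ x⁻¹ = LinearMap.id :=
      (LinearMap.comp_eq_id_comm _ _).1 h1
    have h3 := hx (g * x⁻¹)
    rw [inv_mul_cancel_right] at h3
    rw [h3, LinearMap.comp_assoc, h2, LinearMap.comp_id]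

end WeilRepresentation

namespace PrimeDisc.EvenLattice

open ZMod

variable {V : Type*} [AddCommGroup V] [Module ℝ V] (L : EvenLattice V)

/-- The normalising factor `i^{-r/2} / √p` in the action of `S`. -/
noncomputable def kappa (p : ℕ) : ℂ := Complex.I ^ (-(L.r / 2)) / (Real.sqrt p : ℂ)

/-- Milgram's formula for odd prime discriminant: the normalising factor in the action of `S` is the
inverse of the Gauss sum of the discriminant form. The square of the Gauss sum is `±p`, whence
`r` is even and the division in `r / 2` is exact. -/
theorem IsDiscIso.milgram {p : ℕ} [Fact p.Prime] (hp : p ≠ 2) {φ : L.Disc ≃+ ZMod p} {α : ZMod p}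
    (h : L.IsDiscIso p φ α) : L.kappa p * (quadCharC p α * quadGauss p) = 1 := by
  have : Fintype L.Disc := Fintype.ofEquiv _ φ.symm.toEquiv
  obtain ⟨C, hC, hsum⟩ := L.milgram
  have h1 : ∑ γ, (AddCircle.toCircle (L.q γ) : ℂ) = quadCharC p α * quadGauss p := by
    rw [← sum_stdAddChar_mul_sq hp h.1, ← Equiv.sum_comp φ.toEquiv]
    refine Finset.sum_congr rfl fun γ _ => ?_
    rw [h.2, toCircle_toAddCircle]
    rfl
  have hI : ∀ n : ℤ, Complex.I ^ n = Complex.exp (Real.pi * Complex.I / 2 * n) := by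
    intro n
    conv_lhs => rw [← Complex.exp_pi_div_two_mul_I]
    rw [← Complex.exp_int_mul]
    congr 1
    ring
  have hexp : ∀ n : ℤ, Complex.exp (Real.pi * Complex.I / 4 * n) ^ 2 = Complex.I ^ n := by
    intro n
    rw [← Complex.exp_nat_mul, hI]
    congr 1
    push_cast; ring
  have h2 : ((C ^ 2 : ℝ) : ℂ) * Complex.I ^ L.r = quadCharC p (-1) * p := by
    rw [← quadGauss_sq hp, ← one_mul (quadGauss p ^ 2), ← quadCharC_sq h.1, ← hexp]
    rw [h1] at hsum
    push_cast
    linear_combination -(quadCharC p α * quadGauss p +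
      C * Complex.exp (Real.pi * Complex.I / 4 * L.r)) * hsum
  have hpm : quadCharC p (-1) = 1 ∨ quadCharC p (-1) = -1 := by
    have := quadraticChar_dichotomy (show (-1 : ZMod p) ≠ 0 by simp)
    rw [quadCharC_apply]
    rcases this with h | h <;> simp [h]
  have hp0 : (0 : ℝ) < p := by exact_mod_cast (Fact.out : p.Prime).pos
  have hCp : C ^ 2 = p := by
    have h3 := congrArg (fun z => ‖z‖) h2
    simp only [norm_mul, norm_zpow, Complex.norm_I, one_zpow, mul_one, Complex.norm_real,
      Complex.norm_natCast] at h3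
    rcases hpm with h | h <;> simpa [h] using h3
  have hCs : C = Real.sqrt p := by rw [← hCp, Real.sqrt_sq hC.le]
  have hIr : Complex.I ^ L.r = quadCharC p (-1) := by
    rw [hCp, mul_comm] at h2
    push_cast at h2
    exact mul_right_cancel₀ (by exact_mod_cast hp0.ne') h2
  have heven : Even L.r := by
    by_contra hodd
    rw [Int.not_even_iff_odd] at hodd
    obtain ⟨m, hm⟩ := hodd
    rw [hm, zpow_add₀ Complex.I_ne_zero, zpow_mul, zpow_one] at hIr
    have h4 : ((Complex.I ^ (2 : ℤ)) ^ m) = 1 ∨ ((Complex.I ^ (2 : ℤ)) ^ m) = -1 := by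
      have : (Complex.I ^ (2 : ℤ)) = -1 := by
        rw [zpow_ofNat]; exact Complex.I_sq
      rw [this]
      rcases Int.even_or_odd m with h | h
      · exact Or.inl h.neg_one_zpow
      · exact Or.inr h.neg_one_zpow
    have h5 := congrArg Complex.im hIr
    rcases h4 with h4 | h4 <;> rcases hpm with h | h <;> rw [h4, h] at h5 <;> simp at h5
  obtain ⟨m, hm⟩ := heven
  have hm2 : L.r / 2 = m := by omega
  have hexp2 : Complex.exp (Real.pi * Complex.I / 4 * L.r) = Complex.I ^ m := by
    rw [hI, hm]
    congr 1
    push_cast; ring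
  rw [← h1, hsum, hexp2, kappa, hm2, hCs, zpow_neg]
  have hI0 : Complex.I ^ m ≠ 0 := zpow_ne_zero _ Complex.I_ne_zero
  have hs : (Real.sqrt p : ℂ) ≠ 0 := by
    exact_mod_cast (Real.sqrt_pos.2 hp0).ne'
  field_simp

/-- The sign `(-1)^{r/2}` equals the Legendre symbol of `-1`. -/
theorem IsDiscIso.neg_one_zpow {p : ℕ} [Fact p.Prime] (hp : p ≠ 2) {φ : L.Disc ≃+ ZMod p}
    {α : ZMod p} (h : L.IsDiscIso p φ α) : (-1 : ℂ) ^ (L.r / 2) = quadCharC p (-1) := by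
  have h1 := IsDiscIso.milgram L hp h
  have h2 : (L.kappa p * (quadCharC p α * quadGauss p)) ^ 2 = 1 := by rw [h1, one_pow]
  rw [mul_pow, mul_pow, quadGauss_sq hp, sq (quadCharC p α), quadCharC_sq h.1, kappa, div_pow,
    ← Complex.ofReal_pow, Real.sq_sqrt (Nat.cast_nonneg p), ← zpow_natCast, ← zpow_mul,
    show (-(L.r / 2) * ((2 : ℕ) : ℤ)) = 2 * -(L.r / 2) by push_cast; ring, zpow_mul] at h2
  have h3 : Complex.I ^ (2 : ℤ) = -1 := by
    rw [zpow_ofNat]; exact Complex.I_sq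
  have hp0 : (p : ℂ) ≠ 0 := by exact_mod_cast (Fact.out : p.Prime).ne_zero
  rw [h3, zpow_neg] at h2
  push_cast at h2
  field_simp at h2
  exact h2.symm

/-- The Weil representation on functions on `L'/L`, written down by means of an identification of
the discriminant form with `(𝔽_p, α x² / p)`. -/
noncomputable def explicitWeilRep {p : ℕ} [Fact p.Prime] (hp : p ≠ 2) {φ : L.Disc ≃+ ZMod p}
    {α : ZMod p} (h : L.IsDiscIso p φ α) : Representation ℂ SL(2, ℤ) (L.Disc → ℂ) where
  toFun g := (LinearEquiv.funCongrLeft ℂ ℂ φ.toEquiv).toLinearMap ∘ₗ weilOpSL α (L.kappa p) g ∘ₗ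
    (LinearEquiv.funCongrLeft ℂ ℂ φ.toEquiv).symm.toLinearMap
  map_one' := by
    rw [weilOpSL_one]
    ext v
    simp
  map_mul' g g' := by
    rw [weilOpSL_mul hp h.1 (IsDiscIso.milgram L hp h)]
    refine LinearMap.ext fun v => ?_
    simp only [LinearMap.comp_apply, Module.End.mul_apply, LinearEquiv.coe_coe,
      LinearEquiv.symm_apply_apply]

theorem explicitWeilRep_apply {p : ℕ} [Fact p.Prime] (hp : p ≠ 2) {φ : L.Disc ≃+ ZMod p}
    {α : ZMod p} (h : L.IsDiscIso p φ α) (g : SL(2, ℤ)) (v : L.Disc → ℂ) (γ : L.Disc) :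
    L.explicitWeilRep hp h g v γ = weilOpSL α (L.kappa p) g (fun x => v (φ.symm x)) (φ γ) := rfl

theorem basisVec_apply [DecidableEq L.Disc] (γ δ : L.Disc) :
    L.basisVec γ δ = if δ = γ then 1 else 0 := by
  simp [basisVec, Pi.single_apply]

theorem isWeilRep_explicitWeilRep {p : ℕ} [Fact p.Prime] (hp : p ≠ 2) (hL : Nat.card L.Disc = p)
    {φ : L.Disc ≃+ ZMod p} {α : ZMod p} (h : L.IsDiscIso p φ α) :
    L.IsWeilRep (L.explicitWeilRep hp h) := by
  classical
  refine ⟨fun γ => ?_, fun γ => ?_⟩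
  · ext δ
    rw [explicitWeilRep_apply, weilOpSL_T, weilOp_T, φ.symm_apply_apply, Pi.smul_apply,
      basisVec_apply, smul_eq_mul]
    split_ifs with hδ
    · rw [hδ, h.2, toCircle_toAddCircle]
    · simp
  · ext δ
    rw [explicitWeilRep_apply, weilOpSL_S, weilOp_S, Finset.sum_eq_single (φ γ), φ.symm_apply_apply,
      basisVec_apply, if_pos rfl, mul_one, hL, IsDiscIso.bil_eq L h, ← map_neg,
      toCircle_toAddCircle, kappa]
    · congr 3; ring
    · intro x _ hx
      rw [basisVec_apply, if_neg, mul_zero]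
      intro hx'
      exact hx (by rw [← hx', φ.apply_symm_apply])
    · simp

/-- The matrices `S` and `T` generate `SL₂(ℤ)`. -/
theorem IsWeilRep.unique [Finite L.Disc] {ρ ρ' : Representation ℂ SL(2, ℤ) (L.Disc → ℂ)}
    (h : L.IsWeilRep ρ) (h' : L.IsWeilRep ρ') : ρ = ρ' := by
  classical
  refine MonoidHom.eq_of_eqOn_dense SpecialLinearGroup.SL2Z_generators ?_
  rintro x (rfl | rfl)
  · refine LinearMap.pi_ext' fun γ => LinearMap.ext_ring ?_
    have := (h.2 γ).trans (h'.2 γ).symm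
    convert this <;> simp [basisVec]
  · refine LinearMap.pi_ext' fun γ => LinearMap.ext_ring ?_
    have := (h.1 γ).trans (h'.1 γ).symm
    convert this <;> simp [basisVec]

theorem isWeilRep_weilRep {p : ℕ} [Fact p.Prime] (hp : p ≠ 2) (hL : Nat.card L.Disc = p) :
    L.IsWeilRep L.weilRep := by
  obtain ⟨φ, α, h⟩ := L.exists_discIso p hp hL
  exact Classical.epsilon_spec ⟨_, L.isWeilRep_explicitWeilRep hp hL h⟩

theorem weilRep_apply {p : ℕ} [Fact p.Prime] (hp : p ≠ 2) (hL : Nat.card L.Disc = p)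
    {φ : L.Disc ≃+ ZMod p} {α : ZMod p} (h : L.IsDiscIso p φ α) (g : SL(2, ℤ)) (v : L.Disc → ℂ)
    (γ : L.Disc) :
    L.weilRep g v γ = weilOpSL α (L.kappa p) g (fun x => v (φ.symm x)) (φ γ) := by
  have : Finite L.Disc := Finite.of_equiv _ φ.symm.toEquiv
  rw [IsWeilRep.unique L (L.isWeilRep_weilRep hp hL) (L.isWeilRep_explicitWeilRep hp hL h),
    explicitWeilRep_apply]

end PrimeDisc.EvenLattice

/-! ### Slash operators, the Fricke involution and the cosets of `Γ₀(p)` -/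

namespace PrimeDisc

open UpperHalfPlane

theorem slash_slash (k : ℤ) (f : ℍ → ℂ) {A B : GL (Fin 2) ℝ} (hA : 0 < A.det.val)
    (hB : 0 < B.det.val) : slash k (slash k f A) B = slash k f (A * B) := by
  ext τ
  simp only [slash]
  rw [mul_smul, denom_cocycle_σ, σ, if_pos hB, map_mul]
  simp only [Units.val_mul, ContinuousAlgEquiv.refl_apply]
  rw [Real.mul_rpow hA.le hB.le, mul_zpow]
  push_cast
  ring

theorem slash_SL (k : ℤ) (f : ℍ → ℂ) (M : SL(2, ℤ)) (τ : ℍ) :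
    slash k f (M : GL (Fin 2) ℝ) τ = denom (M : GL (Fin 2) ℝ) τ ^ (-k) * f (M • τ) := by
  simp [slash]

theorem det_SL_pos (M : SL(2, ℤ)) : 0 < ((M : GL (Fin 2) ℝ)).det.val := by simp

theorem slash_slash_SL (k : ℤ) (f : ℍ → ℂ) (M N : SL(2, ℤ)) :
    slash k (slash k f (M : GL (Fin 2) ℝ)) (N : GL (Fin 2) ℝ)
      = slash k f ((M * N : SL(2, ℤ)) : GL (Fin 2) ℝ) := by
  rw [slash_slash k f (det_SL_pos M) (det_SL_pos N), map_mul, map_mul]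

theorem denom_SL (M : SL(2, ℤ)) (τ : ℍ) :
    denom (M : GL (Fin 2) ℝ) τ = (M 1 0 : ℂ) * τ + (M 1 1 : ℂ) := by
  simp [denom]

theorem slash_smul (k : ℤ) (c : ℂ) (f : ℍ → ℂ) (A : GL (Fin 2) ℝ) :
    slash k (fun τ => c * f τ) A = fun τ => c * slash k f A τ := by
  ext τ
  simp only [slash]; ring

/-- Right translation permutes the cosets `Γ₀(p) M`. -/
theorem finsum_cosets_mul_right (p : ℕ) {E : Type*} [AddCommMonoid E] (t : SL(2, ℤ) → E)
    (ht : ∀ g ∈ Gamma0 p, ∀ M, t (g * M) = t M) (N : SL(2, ℤ)) :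
    ∑ᶠ c : Quotient (QuotientGroup.rightRel (Gamma0 p)), t (c.out * N) =
      ∑ᶠ c : Quotient (QuotientGroup.rightRel (Gamma0 p)), t c.out := by
  let R := QuotientGroup.rightRel (Gamma0 p)
  have hR : ∀ (K M M' : SL(2, ℤ)), R M M' → R (M * K) (M' * K) := by
    intro K M M' h
    rw [QuotientGroup.rightRel_apply] at h ⊢
    simpa [mul_assoc] using h
  let e : Quotient R ≃ Quotient R :=
    { toFun := Quotient.map (· * N) (hR N)
      invFun := Quotient.map (· * N⁻¹) (hR N⁻¹)
      left_inv := by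
        intro c
        induction c using Quotient.inductionOn with
        | h M => simp [Quotient.map_mk]
      right_inv := by
        intro c
        induction c using Quotient.inductionOn with
        | h M => simp [Quotient.map_mk] }
  refine finsum_eq_of_bijective e e.bijective fun c => ?_
  have h1 : e c = Quotient.mk R (c.out * N) := by
    conv_lhs => rw [← Quotient.out_eq c]
    rfl
  rw [h1]
  have h2 := QuotientGroup.rightRel_apply.1
    (Quotient.exact (Quotient.out_eq (Quotient.mk R (c.out * N))))
  have h3 := ht _ h2 (Quotient.mk R (c.out * N)).out
  rw [inv_mul_cancel_right] at h3
  exact h3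

variable (p : ℕ) [Fact p.Prime]

theorem prime_pos : (0 : ℝ) < p := by exact_mod_cast (Fact.out : p.Prime).pos

theorem prime_cast_ne_zero : (p : ℂ) ≠ 0 := by exact_mod_cast (Fact.out : p.Prime).ne_zero

theorem det_fricke : (fricke p).det.val = p := by
  simp [fricke, Matrix.det_fin_two]

theorem det_fricke_pos : 0 < (fricke p).det.val := by
  rw [det_fricke]; exact prime_pos p

/-- The point `(τ + j) / p` of the upper half-plane. -/
noncomputable def shiftScale (j : ℤ) (τ : ℍ) : ℍ :=
  ⟨((τ : ℂ) + j) / p, by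
    have h := prime_pos p
    have : ((τ : ℂ) + j) / p = (((1 / p : ℝ)) : ℂ) * ((τ : ℂ) + ((j : ℝ) : ℂ)) := by
      push_cast; ring
    rw [this, Complex.im_ofReal_mul, Complex.add_im, Complex.ofReal_im, add_zero]
    exact mul_pos (by positivity) τ.im_pos⟩

@[simp]
theorem coe_shiftScale (j : ℤ) (τ : ℍ) : (shiftScale p j τ : ℂ) = ((τ : ℂ) + j) / p := rfl

@[simp]
theorem coe_scale (τ : ℍ) : (scale p τ : ℂ) = p * τ := rfl

theorem shiftScale_zero_scale (τ : ℍ) : shiftScale p 0 (scale p τ) = τ := by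
  ext
  simp [prime_cast_ne_zero p]

theorem fricke_smul (τ : ℍ) : fricke p • τ = ModularGroup.S • scale p τ := by
  ext
  rw [coe_smul_of_det_pos (det_fricke_pos p), modular_S_smul]
  simp [num, denom, fricke, inv_neg, neg_div]

theorem denom_fricke (τ : ℍ) : denom (fricke p) τ = p * τ := by
  simp [denom, fricke]

theorem slash_fricke (k : ℤ) (f : ℍ → ℂ) (τ : ℍ) : slash k f (fricke p) τ =
    (((p : ℝ) ^ ((k : ℝ) / 2) : ℝ) : ℂ) * (p * τ) ^ (-k) * f (ModularGroup.S • scale p τ) := by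
  rw [slash, det_fricke, denom_fricke, fricke_smul]

theorem coe_S_mul_T_zpow (j : ℤ) :
    ((ModularGroup.S * ModularGroup.T ^ j : SL(2, ℤ)) : Matrix (Fin 2) (Fin 2) ℤ)
      = !![0, -1; 1, j] := by
  rw [Matrix.SpecialLinearGroup.coe_mul, ModularGroup.coe_S, ModularGroup.coe_T_zpow]
  simp

theorem slash_fricke_ST (k : ℤ) (f : ℍ → ℂ) (j : ℤ) (τ : ℍ) :
    slash k (slash k f (fricke p)) ((ModularGroup.S * ModularGroup.T ^ j : SL(2, ℤ)) :
      GL (Fin 2) ℝ) τ = (((p : ℝ) ^ ((k : ℝ) / 2) : ℝ) : ℂ) * (-p) ^ (-k) *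
        f (shiftScale p j τ) := by
  have hp := prime_cast_ne_zero p
  have hτ : (τ : ℂ) + j ≠ 0 := by
    have := (shiftScale p j τ).ne_zero
    rw [coe_shiftScale] at this
    exact (div_ne_zero_iff.1 this).1
  have h1 : (((ModularGroup.S * ModularGroup.T ^ j : SL(2, ℤ)) • τ : ℍ) : ℂ) =
      -((τ : ℂ) + j)⁻¹ := by
    rw [coe_specialLinearGroup_apply, coe_S_mul_T_zpow]
    simp [neg_div]
  have h2 : ModularGroup.S • scale p ((ModularGroup.S * ModularGroup.T ^ j : SL(2, ℤ)) • τ)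
      = shiftScale p j τ := by
    ext
    rw [modular_S_smul, coe_shiftScale]
    change (-(scale p ((ModularGroup.S * ModularGroup.T ^ j : SL(2, ℤ)) • τ) : ℂ))⁻¹ = _
    rw [coe_scale, h1]
    field_simp
  rw [slash_SL, slash_fricke, h1, h2, denom_SL]
  have h3 : ((ModularGroup.S * ModularGroup.T ^ j : SL(2, ℤ)) 1 0 : ℂ) * τ +
      ((ModularGroup.S * ModularGroup.T ^ j : SL(2, ℤ)) 1 1 : ℂ) = τ + j := by
    rw [coe_S_mul_T_zpow]
    simp
  rw [h3]
  have h4 : (p : ℂ) * -(τ + j : ℂ)⁻¹ = -p * (τ + j : ℂ)⁻¹ := by ring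
  rw [h4, mul_zpow, inv_zpow, zpow_neg (τ + j : ℂ), inv_inv]
  have h5 : ((τ : ℂ) + j) ^ k ≠ 0 := zpow_ne_zero _ hτ
  field_simp

/-- Conjugation by the Fricke involution: `f ∣ W_p` transforms under `Γ₀(p)` as `f` does. -/
theorem slash_fricke_Gamma0 (k : ℤ) (f : ℍ → ℂ)
    (hf : ∀ M ∈ Gamma0 p, ∀ τ : ℍ, slash k f (M : GL (Fin 2) ℝ) τ
      = (legendreSym p (M 1 1) : ℂ) * f τ) (g : SL(2, ℤ)) (hg : g ∈ Gamma0 p) :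
    slash k (slash k f (fricke p)) (g : GL (Fin 2) ℝ) =
      fun τ => (legendreSym p (g 1 1) : ℂ) * slash k f (fricke p) τ := by
  rw [Gamma0_mem, ZMod.intCast_zmod_eq_zero_iff_dvd] at hg
  obtain ⟨c, hc⟩ := hg
  have hdet := g.det_coe
  rw [Matrix.det_fin_two, hc] at hdet
  let g' : SL(2, ℤ) := ⟨!![g 1 1, -c; -(p * g 0 1), g 0 0], by
    rw [Matrix.det_fin_two_of]; linarith⟩
  have hg' : g' ∈ Gamma0 p := by
    rw [Gamma0_mem]; simp [g']
  have e00 : g' 0 0 = g 1 1 := rfl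
  have e01 : g' 0 1 = -c := rfl
  have e10 : g' 1 0 = -(p * g 0 1) := rfl
  have e11 : g' 1 1 = g 0 0 := rfl
  clear_value g'
  have hmul : fricke p * (g : GL (Fin 2) ℝ) = (g' : GL (Fin 2) ℝ) * fricke p := by
    ext i j
    fin_cases i <;> fin_cases j <;>
      simp [fricke, e00, e01, e10, e11, Matrix.mul_apply, Fin.sum_univ_two, hc, mul_comm]
  have hleg : legendreSym p (g' 1 1) = legendreSym p (g 1 1) := by
    have h1 : legendreSym p (g 0 0) * legendreSym p (g 1 1) = 1 := by
      rw [← legendreSym.mul, legendreSym]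
      have : ((g 0 0 * g 1 1 : ℤ) : ZMod p) = 1 := by
        have : g 0 0 * g 1 1 = 1 + p * (g 0 1 * c) := by linarith
        rw [this]; simp
      rw [this, map_one]
    rw [e11]
    rcases Int.isUnit_iff.1 (IsUnit.of_mul_eq_one _ h1) with h | h <;> rw [h] at h1 ⊢ <;> linarith
  rw [slash_slash k f (det_fricke_pos p) (det_SL_pos g), hmul,
    ← slash_slash k f (det_SL_pos g') (det_fricke_pos p), ← hleg, ← slash_smul]
  congr 1
  ext τ
  exact hf g' hg' τ

/-- Representatives of `Γ₀(p) \ SL₂(ℤ)`: the identity and the matrices `S T^j`, `j mod p`. -/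
noncomputable def cosetRep : Option (ZMod p) → SL(2, ℤ)
  | none => 1
  | some j => ModularGroup.S * ModularGroup.T ^ (j.val : ℤ)

theorem mul_inv_ST (M : SL(2, ℤ)) (j : ℤ) :
    (M * (ModularGroup.S * ModularGroup.T ^ j)⁻¹) 1 0 = M 1 0 * j - M 1 1 := by
  rw [Matrix.SpecialLinearGroup.coe_mul, Matrix.SpecialLinearGroup.coe_inv, coe_S_mul_T_zpow,
    Matrix.adjugate_fin_two_of]
  simp [Matrix.mul_apply, Fin.sum_univ_two]
  ring

/-- Every element of `SL₂(ℤ)` lies in exactly one of the cosets `Γ₀(p)`, `Γ₀(p) S T^j`. -/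
theorem existsUnique_cosetRep (M : SL(2, ℤ)) :
    ∃! x : Option (ZMod p), M * (cosetRep p x)⁻¹ ∈ Gamma0 p := by
  have hdet := det_cast_eq_one p M
  by_cases hc : ((M 1 0 : ℤ) : ZMod p) = 0
  · refine ⟨none, by simpa [cosetRep] using hc, ?_⟩
    rintro (_ | j) hx
    · rfl
    · rw [Gamma0_mem, cosetRep, mul_inv_ST] at hx
      push_cast at hx
      rw [hc, zero_mul, zero_sub, neg_eq_zero] at hx
      rw [hc, hx] at hdet
      simp at hdet
  · refine ⟨some (((M 1 1 : ℤ) : ZMod p) / ((M 1 0 : ℤ) : ZMod p)), ?_, ?_⟩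
    · simp only
      rw [Gamma0_mem, cosetRep, mul_inv_ST]
      push_cast
      rw [ZMod.natCast_zmod_val, mul_div_cancel₀ _ hc, sub_self]
    · rintro (_ | j) hx
      · exact absurd (by simpa [cosetRep] using hx) hc
      · rw [Gamma0_mem, cosetRep, mul_inv_ST] at hx
        push_cast at hx
        rw [ZMod.natCast_zmod_val, sub_eq_zero] at hx
        rw [← hx, mul_div_cancel_left₀ _ hc]

theorem finsum_cosets_eq_sum {E : Type*} [AddCommMonoid E] (t : SL(2, ℤ) → E)
    (ht : ∀ g ∈ Gamma0 p, ∀ M, t (g * M) = t M) :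
    ∑ᶠ c : Quotient (QuotientGroup.rightRel (Gamma0 p)), t c.out =
      ∑ x : Option (ZMod p), t (cosetRep p x) := by
  let e : Option (ZMod p) → Quotient (QuotientGroup.rightRel (Gamma0 p)) :=
    fun x => Quotient.mk _ (cosetRep p x)
  have hout : ∀ M : SL(2, ℤ), t (Quotient.mk (QuotientGroup.rightRel (Gamma0 p)) M).out = t M := by
    intro M
    have h1 := Quotient.exact (Quotient.out_eq (Quotient.mk (QuotientGroup.rightRel (Gamma0 p)) M))
    have h2 := QuotientGroup.rightRel_apply.1 h1
    have h3 := ht _ h2 (Quotient.mk (QuotientGroup.rightRel (Gamma0 p)) M).out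
    rw [inv_mul_cancel_right] at h3
    exact h3.symm
  have he : Function.Bijective e := by
    constructor
    · intro x y hxy
      have h1 := QuotientGroup.rightRel_apply.1 (Quotient.exact hxy)
      obtain ⟨z, _, hz⟩ := existsUnique_cosetRep p (cosetRep p y)
      rw [hz x h1, hz y (by simp)]
    · intro c
      induction c using Quotient.inductionOn with
      | h M =>
        obtain ⟨x, hx, _⟩ := existsUnique_cosetRep p M
        exact ⟨x, Quotient.sound (QuotientGroup.rightRel_apply.2 hx)⟩
  rw [← finsum_eq_sum_of_fintype]
  refine (finsum_eq_of_bijective e he fun x => ?_).symm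
  exact (hout _).symm

end PrimeDisc

/-! ### Residue classes of exponents; the Weil representation on coset representatives -/

namespace PrimeDisc

open UpperHalfPlane ZMod

theorem mdifferentiable_sum {ι : Type*} (s : Finset ι) {g : ι → ℍ → ℂ}
    (hg : ∀ i, MDifferentiable 𝓘(ℂ) 𝓘(ℂ) (g i)) :
    MDifferentiable 𝓘(ℂ) 𝓘(ℂ) fun τ => ∑ i ∈ s, g i τ := by
  classical
  induction s using Finset.induction_on with
  | empty => simpa using mdifferentiable_const
  | insert j s hj ih =>
    simp only [Finset.sum_insert hj]
    exact (hg j).add ih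

section ResiduePart

variable (p : ℕ) [Fact p.Prime]

/-- The part `∑_{n ≡ t mod p} a(n) e(nτ/p)` of the expansion `f = ∑ a(n) e(nτ)`, written as an
average of the values `f((τ + j) / p)`. -/
noncomputable def residuePart (f : ℍ → ℂ) (t : ZMod p) (τ : ℍ) : ℂ :=
  (1 / p : ℂ) * ∑ j : ZMod p, stdAddChar (-(t * j)) * f (shiftScale p j.val τ)

theorem e_shiftScale (n j : ℤ) (τ : ℍ) : e (n * shiftScale p j τ) =
    stdAddChar ((n * j : ℤ) : ZMod p) * e (n * τ / p) := by
  have hp := prime_cast_ne_zero p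
  rw [stdAddChar_coe, e, e, ← Complex.exp_add, coe_shiftScale]
  congr 1
  push_cast
  field_simp
  ring

theorem hasSum_residuePart {f : ℍ → ℂ} {a : ℤ → ℂ} (ha : HasQExpansion f a) (t : ZMod p) (τ : ℍ) :
    HasSum (fun n : ℤ => if (n : ZMod p) = t then a n * e (n * τ / p) else 0)
      (residuePart p f t τ) := by
  have hp := prime_cast_ne_zero p
  have h1 : HasSum (fun n : ℤ => (1 / p : ℂ) * ∑ j : ZMod p, stdAddChar (-(t * j)) *
      (a n * e (n * shiftScale p j.val τ))) (residuePart p f t τ) :=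
    (hasSum_sum fun j _ => (ha.2 (shiftScale p j.val τ)).mul_left _).mul_left _
  refine h1.congr_fun fun n => ?_
  have h2 : ∀ j : ZMod p, (stdAddChar (-(t * j)) : ℂ) * (a n * e (n * shiftScale p j.val τ)) =
      stdAddChar (((n : ZMod p) - t) * j) * (a n * e (n * τ / p)) := by
    intro j
    rw [e_shiftScale, show ((n : ZMod p) - t) * j = -(t * j) + ((n * (j.val : ℤ) : ℤ) : ZMod p) by
      push_cast; rw [natCast_zmod_val]; ring, AddChar.map_add_eq_mul]
    ring
  simp only [h2]
  rw [← Finset.sum_mul, sum_stdAddChar_mul]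
  simp only [sub_eq_zero]
  split_ifs
  · field_simp
  · simp

/-- If the coefficients of `f` are supported on those `n` for which `α⁻¹ n` is a square mod `p`,
then the residue classes `α x²` cover `f` twice, apart from the class of zero. -/
theorem sum_residuePart (hp : p ≠ 2) {f : ℍ → ℂ} {a : ℤ → ℂ} (ha : HasQExpansion f a) {α : ZMod p}
    (hα : α ≠ 0) (hs : ∀ n : ℤ, legendreSym p n = -quadraticChar (ZMod p) α → a n = 0) (τ : ℍ) :
    ∑ x : ZMod p, residuePart p f (α * x ^ 2) τ =
      2 * f (shiftScale p 0 τ) - residuePart p f 0 τ := by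
  have h1 := hasSum_sum (s := Finset.univ) fun (x : ZMod p) _ =>
    hasSum_residuePart p ha (α * x ^ 2) τ
  have h2 := ((ha.2 (shiftScale p 0 τ)).mul_left 2).sub (hasSum_residuePart p ha 0 τ)
  refine h1.unique (h2.congr_fun fun n => ?_)
  have hcount : ∑ x : ZMod p, (if (n : ZMod p) = α * x ^ 2 then a n * e (n * τ / p) else 0) =
      ((quadraticChar (ZMod p) (α⁻¹ * n) + 1 : ℤ) : ℂ) * (a n * e (n * τ / p)) := by
    rw [← quadraticChar_card_sqrts (ringChar_zmod_ne_two hp), ← Finset.sum_filter,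
      Finset.sum_const, nsmul_eq_mul]
    congr 2
    congr 1
    ext x
    simp only [Finset.mem_filter, Finset.mem_univ, true_and, Set.mem_toFinset, Set.mem_ofPred_eq]
    rw [eq_inv_mul_iff_mul_eq₀ hα]
    exact eq_comm
  rw [hcount, e_shiftScale]
  simp only [mul_zero, Int.cast_zero, AddChar.map_zero_eq_one, one_mul]
  by_cases hn : (n : ZMod p) = 0
  · rw [if_pos hn, hn, mul_zero, MulChar.map_zero]
    push_cast; ring
  · rw [if_neg hn, sub_zero, map_mul]
    have hinv : quadraticChar (ZMod p) α⁻¹ = quadraticChar (ZMod p) α := by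
      have := quadCharC_inv α
      rw [quadCharC_apply, quadCharC_apply] at this
      exact_mod_cast this
    rw [hinv]
    rcases eq_or_ne (quadraticChar (ZMod p) (n : ZMod p)) (-quadraticChar (ZMod p) α) with h | h
    · rw [hs n h]; simp
    · have h3 : quadraticChar (ZMod p) (n : ZMod p) = quadraticChar (ZMod p) α := by
        rcases quadraticChar_dichotomy hn with h4 | h4 <;>
          rcases quadraticChar_dichotomy hα with h5 | h5 <;> rw [h4, h5] at h ⊢ <;> simp at h
      rw [h3, ← sq, quadraticChar_sq_one hα]
      push_cast; ring

theorem mdifferentiable_residuePart {f : ℍ → ℂ} (hf : MDifferentiable 𝓘(ℂ) 𝓘(ℂ) f) (t : ZMod p) :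
    MDifferentiable 𝓘(ℂ) 𝓘(ℂ) (residuePart p f t) := by
  have h1 : ∀ j : ℤ, MDifferentiable 𝓘(ℂ) 𝓘(ℂ) fun τ => f (shiftScale p j τ) := by
    intro j
    let g : GL (Fin 2) ℝ := Matrix.GeneralLinearGroup.mkOfDetNeZero !![1, (j : ℝ); 0, (p : ℝ)]
      (by simpa [Matrix.det_fin_two] using (Fact.out : p.Prime).ne_zero)
    have hg : 0 < g.det.val := by simpa [g, Matrix.det_fin_two] using (Fact.out : p.Prime).pos
    have h2 : ∀ τ, shiftScale p j τ = g • τ := by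
      intro τ
      ext
      rw [coe_smul_of_det_pos hg]
      simp [num, denom, g]
    simp only [h2]
    exact hf.comp (mdifferentiable_smul hg)
  exact mdifferentiable_const.mul (mdifferentiable_sum _ fun j => mdifferentiable_const.mul (h1 _))

theorem mdifferentiable_comp_scale {f : ℍ → ℂ} (hf : MDifferentiable 𝓘(ℂ) 𝓘(ℂ) f) :
    MDifferentiable 𝓘(ℂ) 𝓘(ℂ) fun τ => f (scale p τ) := by
  let g : GL (Fin 2) ℝ := Matrix.GeneralLinearGroup.mkOfDetNeZero !![(p : ℝ), 0; 0, 1]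
    (by simpa [Matrix.det_fin_two] using (Fact.out : p.Prime).ne_zero)
  have hg : 0 < g.det.val := by simpa [g, Matrix.det_fin_two] using (Fact.out : p.Prime).pos
  have h2 : ∀ τ, scale p τ = g • τ := by
    intro τ
    ext
    rw [coe_smul_of_det_pos hg]
    simp [num, denom, g]
  simp only [h2]
  exact hf.comp (mdifferentiable_smul hg)

end ResiduePart

theorem legendreSym_Gamma0 (p : ℕ) [Fact p.Prime] {g : SL(2, ℤ)} (hg : g ∈ Gamma0 p) :
    legendreSym p (g 0 0) = legendreSym p (g 1 1) ∧
      (legendreSym p (g 1 1) : ℂ) * (legendreSym p (g 1 1) : ℂ) = 1 := by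
  have hdet := det_cast_eq_one p g
  rw [Gamma0_mem] at hg
  rw [hg, mul_zero, sub_zero] at hdet
  have h1 : legendreSym p (g 0 0) * legendreSym p (g 1 1) = 1 := by
    rw [legendreSym, legendreSym, ← map_mul, hdet, map_one]
  rcases Int.isUnit_iff.1 (IsUnit.of_mul_eq_one _ h1) with h | h <;> rw [h] at h1 ⊢
  · rw [one_mul] at h1; rw [h1]; simp
  · have : legendreSym p (g 1 1) = -1 := by linarith
    rw [this]; simp

variable {V : Type*} [AddCommGroup V] [Module ℝ V] (L : EvenLattice V)

section Weil

variable {p : ℕ} [Fact p.Prime] (hp : p ≠ 2) (hL : Nat.card L.Disc = p)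
  {φ : L.Disc ≃+ ZMod p} {α : ZMod p} (h : L.IsDiscIso p φ α)

include hp hL

include h in
theorem weilRep_Gamma0_apply {g : SL(2, ℤ)} (hg : g ∈ Gamma0 p) (v : L.Disc → ℂ) :
    L.weilRep g v 0 = (legendreSym p (g 1 1) : ℂ) * v 0 := by
  have hχ := (legendreSym_Gamma0 p hg).1
  rw [Gamma0_mem] at hg
  rw [L.weilRep_apply hp hL h, weilOpSL, hg, weilOp_apply_of_eq_zero, ← hχ]
  simp [quadCharC_apply, legendreSym]

include h in
theorem weilRep_Gamma0_basisVec {g : SL(2, ℤ)} (hg : g ∈ Gamma0 p) :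
    L.weilRep g (L.basisVec 0) = (legendreSym p (g 1 1) : ℂ) • L.basisVec 0 := by
  classical
  have hχ := (legendreSym_Gamma0 p hg).1
  have hdet := det_cast_eq_one p g
  rw [Gamma0_mem] at hg
  rw [hg, mul_zero, sub_zero] at hdet
  have ha : ((g 0 0 : ℤ) : ZMod p) ≠ 0 := left_ne_zero_of_mul_eq_one hdet
  ext δ
  rw [L.weilRep_apply hp hL h, weilOpSL, hg, weilOp_apply_of_eq_zero, ← hχ, Pi.smul_apply,
    L.basisVec_apply, L.basisVec_apply]
  by_cases hδ : δ = 0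
  · subst hδ
    simp [quadCharC_apply, legendreSym]
  · simp [hδ, ha]

include h in
theorem weilRep_inv_Gamma0_basisVec {g : SL(2, ℤ)} (hg : g ∈ Gamma0 p) :
    L.weilRep g⁻¹ (L.basisVec 0) = (legendreSym p (g 1 1) : ℂ) • L.basisVec 0 := by
  rw [weilRep_Gamma0_basisVec L hp hL h (inv_mem hg), ← (legendreSym_Gamma0 p hg).1]
  congr 3
  rw [Matrix.SpecialLinearGroup.coe_inv, Matrix.adjugate_fin_two]
  simp

include h in
theorem weilRep_ST_apply_zero (j : ℤ) (v : L.Disc → ℂ) :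
    L.weilRep (ModularGroup.S * ModularGroup.T ^ j) v 0 =
      L.kappa p * ∑ y : ZMod p, stdAddChar (α * ((j : ZMod p) * y ^ 2)) * v (φ.symm y) := by
  rw [L.weilRep_apply hp hL h, weilOpSL, coe_S_mul_T_zpow]
  simp [weilOp_apply_of_ne_zero]

include h in
theorem weilRep_S_apply_zero (v : L.Disc → ℂ) : L.weilRep ModularGroup.S v 0 =
      L.kappa p * ∑ y : ZMod p, v (φ.symm y) := by
  have := weilRep_ST_apply_zero L hp hL h 0 v
  simpa using this

include h in
theorem weilRep_ST_inv_basisVec (j : ℤ) (δ : L.Disc) :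
    L.weilRep (ModularGroup.S * ModularGroup.T ^ j)⁻¹ (L.basisVec 0) δ =
      quadCharC p (-1) * L.kappa p * stdAddChar (-(α * φ δ ^ 2 * (j : ZMod p))) := by
  classical
  have hmat : ((ModularGroup.S * ModularGroup.T ^ j)⁻¹ : SL(2, ℤ)).1 = !![j, 1; -1, 0] := by
    rw [Matrix.SpecialLinearGroup.coe_inv, coe_S_mul_T_zpow, Matrix.adjugate_fin_two_of]
    simp
  rw [L.weilRep_apply hp hL h, weilOpSL, hmat]
  simp only [Matrix.of_apply, Matrix.cons_val', Matrix.cons_val_zero, Matrix.cons_val_one,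
    Matrix.cons_val_fin_one, Int.cast_neg, Int.cast_one, Int.cast_zero]
  rw [weilOp_apply_of_ne_zero _ _ (by simp), Finset.sum_eq_single 0]
  · rw [map_zero, L.basisVec_apply, if_pos rfl, mul_one]
    congr 2
    ring
  · intro y _ hy
    rw [L.basisVec_apply, if_neg (by simpa using hy), mul_zero]
  · simp

include h in
theorem weilRep_neg_one (v : L.Disc → ℂ) (δ : L.Disc) :
    L.weilRep (-1) v δ = quadCharC p (-1) * v (-δ) := by
  rw [L.weilRep_apply hp hL h, weilOpSL]
  have h0 : (((-1 : SL(2, ℤ)) 1 0 : ℤ) : ZMod p) = 0 := by simp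
  rw [h0, weilOp_apply_of_eq_zero]
  simp

end Weil

end PrimeDisc

/-! ### The induced function -/

namespace PrimeDisc

open UpperHalfPlane ZMod

variable {V : Type*} [AddCommGroup V] [Module ℝ V] (L : EvenLattice V)

section Constants

variable {p : ℕ} [Fact p.Prime] {k : ℤ} (hk : k ≡ L.r / 2 [ZMOD 2])

theorem neg_one_zpow_congr {m n : ℤ} (h : m ≡ n [ZMOD 2]) : (-1 : ℂ) ^ m = (-1) ^ n := by
  obtain ⟨c, hc⟩ := h.dvd
  rw [show n = m + 2 * c by linarith, zpow_add₀ (by simp), zpow_mul]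
  simp

theorem neg_one_zpow_mul_self (m : ℤ) : (-1 : ℂ) ^ m * (-1) ^ m = 1 := by
  rw [← mul_zpow]; simp

/-- The factor `i^{r/2} p^{k/2-1/2}` in front of the sum over the cosets. -/
noncomputable def inducedConst (p : ℕ) (k : ℤ) : ℂ :=
  Complex.I ^ (L.r / 2) * (((p : ℝ) ^ ((k : ℝ) / 2 - 1 / 2) : ℝ) : ℂ)

theorem sqrt_prime_mul_self (p : ℕ) : ((Real.sqrt p : ℝ) : ℂ) * ((Real.sqrt p : ℝ) : ℂ) = p := by
  rw [← Complex.ofReal_mul, Real.mul_self_sqrt (by positivity)]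
  simp

theorem sqrt_prime_ne_zero (p : ℕ) [Fact p.Prime] : ((Real.sqrt p : ℝ) : ℂ) ≠ 0 := by
  have := sqrt_prime_mul_self p
  intro h
  rw [h, zero_mul] at this
  exact prime_cast_ne_zero p this.symm

include hk in
theorem kappa_mul_self : L.kappa p * L.kappa p * p = (-1 : ℂ) ^ k := by
  rw [EvenLattice.kappa, neg_one_zpow_congr hk, ← sqrt_prime_mul_self p]
  have h0 := sqrt_prime_ne_zero p
  have h1 : Complex.I ^ (-(L.r / 2)) * Complex.I ^ (-(L.r / 2)) = (-1 : ℂ) ^ (L.r / 2) := by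
    rw [← mul_zpow, Complex.I_mul_I, zpow_neg, ← inv_zpow]
    norm_num
  field_simp
  rw [sq, h1]

include hk in
theorem kappa_ne_zero : L.kappa p ≠ 0 := by
  intro h
  have := kappa_mul_self L (p := p) hk
  rw [h] at this
  exact zpow_ne_zero k (by simp : (-1 : ℂ) ≠ 0) (by simpa using this.symm)

theorem inducedConst_mul_kappa :
    inducedConst L p k * L.kappa p * (((p : ℝ) ^ ((k : ℝ) / 2) : ℝ) : ℂ) = p ^ k / p := by
  have hp := prime_pos p
  have h1 : Complex.I ^ (L.r / 2) * Complex.I ^ (-(L.r / 2)) = 1 := by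
    rw [← zpow_add₀ Complex.I_ne_zero]; simp
  have h2 : (p : ℝ) ^ ((k : ℝ) / 2 - 1 / 2) * (p : ℝ) ^ ((k : ℝ) / 2) / Real.sqrt p =
      p ^ k / p := by
    rw [Real.sqrt_eq_rpow, ← Real.rpow_add hp, ← Real.rpow_sub hp, ← Real.rpow_intCast,
      ← Real.rpow_sub_one hp.ne']
    congr 1
    ring
  have h3 : (((p : ℝ) ^ ((k : ℝ) / 2 - 1 / 2) : ℝ) : ℂ) * (((p : ℝ) ^ ((k : ℝ) / 2) : ℝ) : ℂ) /
      ((Real.sqrt p : ℝ) : ℂ) = p ^ k / p := by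
    have h4 := congrArg (fun x : ℝ => (x : ℂ)) h2
    simpa only [Complex.ofReal_mul, Complex.ofReal_div, Complex.ofReal_zpow,
      Complex.ofReal_natCast] using h4
  rw [inducedConst, EvenLattice.kappa, ← h3]
  linear_combination ((((p : ℝ) ^ ((k : ℝ) / 2 - 1 / 2) : ℝ) : ℂ) *
    (((p : ℝ) ^ ((k : ℝ) / 2) : ℝ) : ℂ) / ((Real.sqrt p : ℝ) : ℂ)) * h1

theorem inducedConst_mul_kappa' : inducedConst L p k * L.kappa p *
    ((((p : ℝ) ^ ((k : ℝ) / 2) : ℝ) : ℂ) * (-p) ^ (-k)) = (-1) ^ k * (1 / p) := by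
  have hp := prime_cast_ne_zero p
  rw [← mul_assoc, inducedConst_mul_kappa, neg_eq_neg_one_mul, mul_zpow, zpow_neg, zpow_neg,
    ← inv_zpow]
  have := zpow_ne_zero k hp
  field_simp

include hk in
theorem inducedConst_eq_kappa : inducedConst L p k *
    ((((p : ℝ) ^ ((k : ℝ) / 2) : ℝ) : ℂ) * (-p) ^ (-k)) = L.kappa p := by
  have h1 := inducedConst_mul_kappa' L (p := p) (k := k)
  rw [← kappa_mul_self L (p := p) hk] at h1
  have hp := prime_cast_ne_zero p
  refine mul_left_cancel₀ (kappa_ne_zero L (p := p) hk) ?_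
  field_simp at h1
  linear_combination h1

end Constants

theorem denom_S (τ : ℍ) : denom (ModularGroup.S : GL (Fin 2) ℝ) τ = τ := by
  rw [denom_SL, ModularGroup.coe_S]; simp

theorem S_smul_S_smul (τ : ℍ) : ModularGroup.S • ModularGroup.S • τ = τ := by
  ext
  rw [modular_S_smul]
  change (-((ModularGroup.S • τ : ℍ) : ℂ))⁻¹ = τ
  rw [modular_S_smul]
  change (-(-(τ : ℂ))⁻¹)⁻¹ = τ
  rw [inv_neg, inv_neg, inv_neg, neg_neg, inv_inv]

section Induced

variable {p : ℕ} [Fact p.Prime] (hp : p ≠ 2) (hL : Nat.card L.Disc = p)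
  {φ : L.Disc ≃+ ZMod p} {α : ZMod p} (h : L.IsDiscIso p φ α)
  {k : ℤ} (hk : k ≡ L.r / 2 [ZMOD 2]) {f : ℍ → ℂ}
  (hf : ∀ M ∈ Gamma0 p, ∀ τ : ℍ, slash k f (M : GL (Fin 2) ℝ) τ = (legendreSym p (M 1 1) : ℂ) * f τ)

include hp hL h hf

/-- Both `f ∣ W_p` and `ρ(g)⁻¹ 𝔢_0` pick up the sign `χ_p(d)`, and the two signs cancel. -/
theorem inducedTerm_Gamma0_mul (g : SL(2, ℤ)) (hg : g ∈ Gamma0 p) (M : SL(2, ℤ)) :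
    inducedTerm L p k f (g * M) = inducedTerm L p k f M := by
  ext τ δ
  have h1 : L.weilRep (g * M)⁻¹ (L.basisVec 0) =
      (legendreSym p (g 1 1) : ℂ) • L.weilRep M⁻¹ (L.basisVec 0) := by
    rw [mul_inv_rev, map_mul, Module.End.mul_apply, weilRep_inv_Gamma0_basisVec L hp hL h hg,
      _root_.map_smul]
  simp only [inducedTerm]
  rw [h1, ← slash_slash_SL, slash_fricke_Gamma0 p k f hf g hg, slash_smul, smul_smul]
  simp only [Pi.smul_apply, smul_eq_mul]
  linear_combination (slash k (slash k f (fricke p)) (M : GL (Fin 2) ℝ) τ *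
    L.weilRep M⁻¹ (L.basisVec 0) δ) * (legendreSym_Gamma0 p hg).2

theorem induced_eq_sum (τ : ℍ) : induced L p k f τ = inducedConst L p k •
    ∑ x : Option (ZMod p), inducedTerm L p k f (cosetRep p x) τ := by
  rw [induced, finsum_cosets_eq_sum p (fun M => inducedTerm L p k f M τ)]
  · rfl
  · intro g hg M
    rw [inducedTerm_Gamma0_mul L hp hL h hf g hg M]

omit hp hL h hf in
theorem inducedTerm_smul (M N : SL(2, ℤ)) (τ : ℍ) :
    inducedTerm L p k f M (N • τ) =
      denom (N : GL (Fin 2) ℝ) τ ^ k • L.weilRep N (inducedTerm L p k f (M * N) τ) := by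
  simp only [inducedTerm]
  have h1 : L.weilRep M⁻¹ (L.basisVec 0) = L.weilRep N (L.weilRep (M * N)⁻¹ (L.basisVec 0)) := by
    rw [← Module.End.mul_apply, ← map_mul, mul_inv_rev, mul_inv_cancel_left]
  rw [h1, ← slash_slash_SL, slash_SL k _ N, _root_.map_smul, smul_smul, zpow_neg,
    mul_inv_cancel_left₀]
  exact zpow_ne_zero _ (denom_ne_zero _ _)

theorem induced_smul (N : SL(2, ℤ)) (τ : ℍ) : induced L p k f (N • τ) =
    denom (N : GL (Fin 2) ℝ) τ ^ k • L.weilRep N (induced L p k f τ) := by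
  have h1 : ∀ g ∈ Gamma0 p, ∀ M, inducedTerm L p k f (g * M) = inducedTerm L p k f M :=
    inducedTerm_Gamma0_mul L hp hL h hf
  rw [induced_eq_sum L hp hL h hf τ, _root_.map_smul, map_sum, smul_comm, Finset.smul_sum]
  have h2 := finsum_cosets_eq_sum p (fun M => denom (N : GL (Fin 2) ℝ) τ ^ k •
    L.weilRep N (inducedTerm L p k f M τ)) fun g hg M => by rw [h1 g hg M]
  have h3 := finsum_cosets_mul_right p (fun M => denom (N : GL (Fin 2) ℝ) τ ^ k •
    L.weilRep N (inducedTerm L p k f M τ)) (fun g hg M => by rw [h1 g hg M]) N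
  rw [← h2, ← h3]
  simp only [induced, inducedTerm_smul]
  rfl

include hk

/-- The components of the induced function: the cosets of `S T^j` together yield the part of `f`
with exponents `n ≡ α φ(δ)²`, and the identity coset contributes a multiple of `f ∣ W_p` to `F_0`. -/
theorem induced_apply (τ : ℍ) (δ : L.Disc) : induced L p k f τ δ =
    residuePart p f (α * φ δ ^ 2) τ +
      inducedConst L p k * slash k f (fricke p) τ * L.basisVec 0 δ := by
  have hχ : quadCharC p (-1) = (-1 : ℂ) ^ k := by
    rw [← h.neg_one_zpow L hp, neg_one_zpow_congr hk]
  have h1 : inducedTerm L p k f (cosetRep p none) τ δ =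
      slash k f (fricke p) τ * L.basisVec 0 δ := by
    rw [inducedTerm, cosetRep, slash_SL, denom_SL]
    simp
  have h2 : ∀ j : ZMod p, inducedTerm L p k f (cosetRep p (some j)) τ δ =
      (((p : ℝ) ^ ((k : ℝ) / 2) : ℝ) : ℂ) * (-p) ^ (-k) * f (shiftScale p j.val τ) *
        ((-1) ^ k * L.kappa p * stdAddChar (-(α * φ δ ^ 2 * j))) := by
    intro j
    rw [inducedTerm, cosetRep, slash_fricke_ST, Pi.smul_apply, smul_eq_mul,
      weilRep_ST_inv_basisVec L hp hL h, hχ, Int.cast_natCast, natCast_zmod_val]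
  rw [induced_eq_sum L hp hL h hf, Fintype.sum_option, Pi.smul_apply, Pi.add_apply,
    Finset.sum_apply, h1, smul_eq_mul, mul_add, add_comm, mul_assoc, residuePart, Finset.mul_sum,
    Finset.mul_sum]
  congr 1
  refine Finset.sum_congr rfl fun j _ => ?_
  rw [h2]
  linear_combination (f (shiftScale p j.val τ) * (-1) ^ k * stdAddChar (-(α * φ δ ^ 2 * j))) *
    inducedConst_mul_kappa' L (p := p) (k := k) + (f (shiftScale p j.val τ) * (1 / p) *
      stdAddChar (-(α * φ δ ^ 2 * j))) * neg_one_zpow_mul_self k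

/-- The identity coset contributes as much to `F_0` as the other cosets together. The difference
`u` of the two contributions satisfies `u(-1/τ) = -κ τ^k u(τ)` with `κ² = (-1)^k / p`; as `S` acts
as an involution on the upper half-plane, `u = u / p`. -/
theorem inducedConst_mul_slash_fricke {a : ℤ → ℂ} (ha : HasQExpansion f a)
    (hs : ∀ n : ℤ, legendreSym p n = -quadraticChar (ZMod p) α → a n = 0) (τ : ℍ) :
    inducedConst L p k * slash k f (fricke p) τ = residuePart p f 0 τ := by
  classical
  set u : ℍ → ℂ := fun τ => inducedConst L p k * slash k f (fricke p) τ - residuePart p f 0 τ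
    with hu
  have h0 : ∀ τ, induced L p k f τ 0 =
      residuePart p f 0 τ + inducedConst L p k * slash k f (fricke p) τ := by
    intro τ
    rw [induced_apply L hp hL h hk hf, L.basisVec_apply, if_pos rfl]
    simp
  have hsum : ∀ τ, ∑ y : ZMod p, induced L p k f τ (φ.symm y) = 2 * f (shiftScale p 0 τ) + u τ := by
    intro τ
    have h1 : ∀ y : ZMod p, induced L p k f τ (φ.symm y) = residuePart p f (α * y ^ 2) τ +
        if y = 0 then inducedConst L p k * slash k f (fricke p) τ else 0 := by
      intro y
      rw [induced_apply L hp hL h hk hf, L.basisVec_apply]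
      simp
    simp only [h1, Finset.sum_add_distrib, sum_residuePart p hp ha h.1 hs, Finset.sum_ite_eq',
      Finset.mem_univ, if_true, hu]
    ring
  have hstep : ∀ τ, u (ModularGroup.S • τ) = -(τ : ℂ) ^ k * L.kappa p * u τ := by
    intro τ
    have h1 := congrFun (induced_smul L hp hL h hf ModularGroup.S τ) 0
    rw [h0, Pi.smul_apply, weilRep_S_apply_zero L hp hL h, hsum, denom_S, smul_eq_mul] at h1
    have h2 := slash_fricke_ST p k f 0 τ
    rw [zpow_zero, mul_one, slash_SL, denom_S] at h2
    have hτ : (τ : ℂ) ^ k ≠ 0 := zpow_ne_zero _ τ.ne_zero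
    have h3 : inducedConst L p k * slash k f (fricke p) (ModularGroup.S • τ) =
        τ ^ k * L.kappa p * f (shiftScale p 0 τ) := by
      rw [← inducedConst_eq_kappa L (p := p) hk]
      have h4 : slash k f (fricke p) (ModularGroup.S • τ) =
          τ ^ k * ((((p : ℝ) ^ ((k : ℝ) / 2) : ℝ) : ℂ) * (-p : ℂ) ^ (-k) * f (shiftScale p 0 τ)) := by
        rw [← h2, zpow_neg, mul_inv_cancel_left₀ hτ]
      rw [h4]
      ring
    simp only [hu] at h1 ⊢
    linear_combination 2 * h3 - h1
  have hfin : u τ = u τ / p := by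
    have h1 := hstep (ModularGroup.S • τ)
    rw [S_smul_S_smul, hstep τ, modular_S_smul] at h1
    have h2 : ((⟨(-(τ : ℂ))⁻¹, τ.im_inv_neg_coe_pos⟩ : ℍ) : ℂ) ^ k * (τ : ℂ) ^ k = (-1) ^ k := by
      rw [← mul_zpow]
      congr 1
      change (-(τ : ℂ))⁻¹ * τ = -1
      rw [inv_neg, neg_mul, inv_mul_cancel₀ τ.ne_zero]
    have h3 := kappa_mul_self L (p := p) hk
    have h4 := neg_one_zpow_mul_self k
    rw [eq_div_iff (prime_cast_ne_zero p)]
    conv_lhs => rw [h1]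
    linear_combination (L.kappa p * L.kappa p * p * u τ) * h2 + (-1) ^ k * u τ * h3 + u τ * h4
  have hp1 : (p : ℂ) ≠ 1 := by exact_mod_cast (Fact.out : p.Prime).ne_one
  have hu0 : u τ = 0 := by
    rw [eq_div_iff (prime_cast_ne_zero p)] at hfin
    have : u τ * ((p : ℂ) - 1) = 0 := by linear_combination hfin
    exact (mul_eq_zero.1 this).resolve_right (sub_ne_zero.2 hp1)
  exact sub_eq_zero.1 hu0

theorem induced_apply_eq_residuePart {a : ℤ → ℂ} (ha : HasQExpansion f a)
    (hs : ∀ n : ℤ, legendreSym p n = -quadraticChar (ZMod p) α → a n = 0) (τ : ℍ) (δ : L.Disc) :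
    induced L p k f τ δ =
      (1 + L.basisVec 0 δ) * residuePart p f (α * φ δ ^ 2) τ := by
  classical
  rw [induced_apply L hp hL h hk hf, inducedConst_mul_slash_fricke L hp hL h hk hf ha hs,
    L.basisVec_apply]
  split_ifs with hδ
  · subst hδ
    simp; ring
  · ring

end Induced

end PrimeDisc

/-! ### Fourier expansions -/

namespace PrimeDisc

open UpperHalfPlane ZMod

theorem hasSum_residuePart_subtype (p : ℕ) [Fact p.Prime] {f : ℍ → ℂ} {a : ℤ → ℂ}
    (ha : HasQExpansion f a) {t : ZMod p} {P : ℤ → Prop} (hP : ∀ n, P n ↔ (n : ZMod p) = t)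
    (τ : ℍ) :
    HasSum (fun n : {n : ℤ // P n} => a n * e ((n : ℤ) * τ / p)) (residuePart p f t τ) := by
  have h1 := hasSum_residuePart p ha t τ
  rw [← (Subtype.val_injective (p := P)).hasSum_iff] at h1
  · refine h1.congr_fun fun n => ?_
    simp [(hP n).1 n.2]
  · intro n hn
    rw [Subtype.range_coe_subtype, Set.mem_ofPred_eq, hP] at hn
    exact if_neg hn

variable {V : Type*} [AddCommGroup V] [Module ℝ V] (L : EvenLattice V)

section Expansions

variable {p : ℕ} [Fact p.Prime] {φ : L.Disc ≃+ ZMod p} {α : ZMod p} (h : L.IsDiscIso p φ α)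

include h

theorem intCast_div_eq_q_iff (n : ℤ) (γ : L.Disc) :
    (((n : ℝ) / p : ℝ) : UnitAddCircle) = L.q γ ↔ (n : ZMod p) = α * φ γ ^ 2 := by
  rw [h.2, ← toAddCircle_intCast, (toAddCircle_injective p).eq_iff]

theorem exists_intCast_div_eq {x : ℝ} {γ : L.Disc} (hx : (x : UnitAddCircle) = L.q γ) :
    ∃ n : ℤ, (n : ℝ) / p = x := by
  have hp := prime_pos p
  rw [h.2, ← natCast_zmod_val (α * φ γ ^ 2), ← Int.cast_natCast, toAddCircle_intCast] at hx
  rw [← sub_eq_zero, ← AddCircle.coe_sub, AddCircle.coe_eq_zero_iff] at hx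
  obtain ⟨m, hm⟩ := hx
  refine ⟨(α * φ γ ^ 2).val + p * m, ?_⟩
  rw [zsmul_eq_mul, mul_one] at hm
  push_cast at hm ⊢
  field_simp at hm ⊢
  linear_combination hm

/-- An expansion in `e(nτ)` with `n ∈ ℤ + q(γ)` amounts to one in `e(nτ/p)` with integers `n` that
represent the value `p q(γ)` modulo `p`. -/
theorem exists_expansion_iff (γ : L.Disc) (g : ℍ → ℂ) :
    (∃ a : {x : ℝ // (x : UnitAddCircle) = L.q γ} → ℂ,
      (∃ N : ℝ, ∀ n : {x : ℝ // (x : UnitAddCircle) = L.q γ}, (n : ℝ) < N → a n = 0) ∧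
      ∀ τ : ℍ, HasSum (fun n => a n * e ((n : ℝ) * τ)) (g τ)) ↔
    ∃ b : ℤ → ℂ, (∃ N : ℤ, ∀ n < N, b n = 0) ∧ (∀ n : ℤ, (n : ZMod p) ≠ α * φ γ ^ 2 → b n = 0) ∧
      ∀ τ : ℍ, HasSum (fun n : ℤ => b n * e (n * τ / p)) (g τ) := by
  classical
  have hp := prime_pos p
  have hpc := prime_cast_ne_zero p
  let E : {n : ℤ // (n : ZMod p) = α * φ γ ^ 2} ≃ {x : ℝ // (x : UnitAddCircle) = L.q γ} :=
    Equiv.ofBijective (fun n => ⟨(n : ℤ) / p, (intCast_div_eq_q_iff L h n γ).2 n.2⟩) <| by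
      constructor
      · intro m n hmn
        have h1 : ((m : ℤ) : ℝ) / p = (n : ℤ) / p := congrArg Subtype.val hmn
        field_simp at h1
        exact Subtype.ext (by exact_mod_cast h1)
      · rintro ⟨x, hx⟩
        obtain ⟨n, rfl⟩ := exists_intCast_div_eq L h hx
        exact ⟨⟨n, (intCast_div_eq_q_iff L h n γ).1 hx⟩, rfl⟩
  have hE : ∀ n, ((E n : ℝ) : ℂ) = (n : ℤ) / p := by
    intro n
    change (((((n : ℤ) : ℝ) / p : ℝ)) : ℂ) = _
    push_cast; rfl
  have hsum : ∀ (b : ℤ → ℂ), (∀ n : ℤ, (n : ZMod p) ≠ α * φ γ ^ 2 → b n = 0) → ∀ τ : ℍ,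
      (HasSum (fun x => b (E.symm x) * e ((x : ℝ) * τ)) (g τ) ↔
        HasSum (fun n : ℤ => b n * e (n * τ / p)) (g τ)) := by
    intro b hb τ
    rw [← E.hasSum_iff, ← (Subtype.val_injective
      (p := fun n : ℤ => (n : ZMod p) = α * φ γ ^ 2)).hasSum_iff]
    · refine iff_of_eq (congrArg (fun s => HasSum s (g τ)) (funext fun n => ?_))
      simp only [Function.comp_apply, Equiv.symm_apply_apply, hE]
      rw [div_mul_eq_mul_div]
    · intro n hn
      rw [Subtype.range_coe_subtype, Set.mem_ofPred_eq] at hn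
      rw [hb n hn, zero_mul]
  constructor
  · rintro ⟨a, ⟨N, hN⟩, ha⟩
    let b : ℤ → ℂ := fun n => if hn : (n : ZMod p) = α * φ γ ^ 2 then a (E ⟨n, hn⟩) else 0
    have hb : ∀ n : ℤ, (n : ZMod p) ≠ α * φ γ ^ 2 → b n = 0 := fun n hn => dif_neg hn
    refine ⟨b, ⟨⌊N * p⌋, fun n hn => ?_⟩, hb, fun τ => ?_⟩
    · by_cases hn' : (n : ZMod p) = α * φ γ ^ 2
      · simp only [b, dif_pos hn']
        refine hN _ ?_
        change (n : ℝ) / p < N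
        rw [div_lt_iff₀ hp]
        exact (Int.cast_lt.2 hn).trans_le (Int.floor_le _)
      · exact hb n hn'
    · rw [← hsum b hb]
      refine (ha τ).congr_fun fun x => ?_
      have h1 : b (E.symm x) = a x := by
        simp only [b]
        rw [dif_pos (E.symm x).2]
        simp
      rw [h1]
  · rintro ⟨b, ⟨N, hN⟩, hb, hsb⟩
    refine ⟨fun x => b (E.symm x), ⟨N / p, fun x hx => hN _ ?_⟩, fun τ => (hsum b hb τ).2 (hsb τ)⟩
    obtain ⟨n, rfl⟩ := E.surjective x
    rw [Equiv.symm_apply_apply]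
    have h1 : ((n : ℤ) : ℝ) / p < N / p := hx
    have h2 := (div_lt_div_iff_of_pos_right hp).1 h1
    exact_mod_cast h2

end Expansions

section Induced

variable {p : ℕ} [Fact p.Prime] (hp : p ≠ 2) (hL : Nat.card L.Disc = p)
  {φ : L.Disc ≃+ ZMod p} {α : ZMod p} (h : L.IsDiscIso p φ α)
  {k : ℤ} (hk : k ≡ L.r / 2 [ZMOD 2]) {f : ℍ → ℂ}

include hp hL h hk

theorem induced_mem_vectorForms (hf : f ∈ signedForms p k (L.discSign p)) :
    induced L p k f ∈ vectorForms L k := by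
  obtain ⟨⟨hf1, hf2, -⟩, a, ha, hs⟩ := hf
  rw [← EvenLattice.IsDiscIso.quadraticChar_eq L h] at hs
  have hF := induced_apply_eq_residuePart L hp hL h hk hf2 ha hs
  refine ⟨fun γ => ?_, fun M τ => induced_smul L hp hL h hf2 M τ, fun γ => ?_⟩
  · simp only [hF]
    exact mdifferentiable_const.mul (mdifferentiable_residuePart p hf1 _)
  · rw [exists_expansion_iff L h]
    obtain ⟨N, hN⟩ := ha.1
    refine ⟨fun n => (1 + L.basisVec 0 γ) * if (n : ZMod p) = α * φ γ ^ 2 then a n else 0,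
      ⟨N, fun n hn => ?_⟩, fun n hn => ?_, fun τ => ?_⟩
    · simp [hN n hn]
    · simp [hn]
    · rw [hF]
      refine ((hasSum_residuePart p ha _ τ).mul_left _).congr_fun fun n => ?_
      rw [mul_assoc, ite_mul, zero_mul]

end Induced

end PrimeDisc

/-! ### The inverse map -/

namespace PrimeDisc

open UpperHalfPlane ZMod

variable {V : Type*} [AddCommGroup V] [Module ℝ V] (L : EvenLattice V)

section ToScalar

variable {p : ℕ} [Fact p.Prime] (hp : p ≠ 2) (hL : Nat.card L.Disc = p)
  {φ : L.Disc ≃+ ZMod p} {α : ZMod p} (h : L.IsDiscIso p φ α)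
  {k : ℤ} {F : ℍ → L.Disc → ℂ} (hF : F ∈ vectorForms L k)

theorem toScalarConst_mul_kappa : Complex.I ^ (L.r / 2) / 2 *
    (((p : ℝ) ^ ((1 - (k : ℝ)) / 2) : ℝ) : ℂ) * (((p : ℝ) ^ ((k : ℝ) / 2) : ℝ) : ℂ) * L.kappa p =
      1 / 2 := by
  have h1 : Complex.I ^ (L.r / 2) * Complex.I ^ (-(L.r / 2)) = 1 := by
    rw [← zpow_add₀ Complex.I_ne_zero]; simp
  have h2 : (((p : ℝ) ^ ((1 - (k : ℝ)) / 2) : ℝ) : ℂ) * (((p : ℝ) ^ ((k : ℝ) / 2) : ℝ) : ℂ) =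
      ((Real.sqrt p : ℝ) : ℂ) := by
    rw [← Complex.ofReal_mul, ← Real.rpow_add (prime_pos p), Real.sqrt_eq_rpow]
    congr 2
    ring
  have h3 := sqrt_prime_ne_zero p
  rw [EvenLattice.kappa, mul_assoc (Complex.I ^ (L.r / 2) / 2), h2]
  field_simp
  exact h1

include hp hL h hF

/-- The second description of the inverse map, `½ ∑_γ F_γ(pτ)`. -/
theorem toScalar_apply (τ : ℍ) :
    toScalar L p k F τ = 1 / 2 * ∑ y : ZMod p, F (scale p τ) (φ.symm y) := by
  have hz : (scale p τ : ℂ) ^ k ≠ 0 := zpow_ne_zero _ (scale p τ).ne_zero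
  rw [toScalar, slash_fricke, hF.2.1, Pi.smul_apply, weilRep_S_apply_zero L hp hL h, denom_S,
    smul_eq_mul, ← coe_scale, zpow_neg]
  rw [← toScalarConst_mul_kappa L (p := p) (k := k)]
  field_simp

theorem slash_zero_component_Gamma0 (M : SL(2, ℤ)) (hM : M ∈ Gamma0 p) (τ : ℍ) :
    slash k (fun z => F z 0) (M : GL (Fin 2) ℝ) τ = (legendreSym p (M 1 1) : ℂ) * F τ 0 := by
  rw [slash_SL, hF.2.1, Pi.smul_apply, smul_eq_mul, weilRep_Gamma0_apply L hp hL h hM, zpow_neg,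
    inv_mul_cancel_left₀ (zpow_ne_zero _ (denom_ne_zero _ _))]

theorem slash_toScalar_Gamma0 (M : SL(2, ℤ)) (hM : M ∈ Gamma0 p) :
    slash k (toScalar L p k F) (M : GL (Fin 2) ℝ) =
      fun τ => (legendreSym p (M 1 1) : ℂ) * toScalar L p k F τ := by
  unfold toScalar
  rw [slash_smul, slash_fricke_Gamma0 p k _ (slash_zero_component_Gamma0 L hp hL h hF) M hM]
  ext τ
  ring

/-- The image of `F` has the expansion with coefficients `½ ∑_γ a(γ, n/p)`; since `F_γ` involves
only exponents `n/p` with `n ≡ α φ(γ)²`, they vanish for `χ_p(n) = -χ_p(α)`. -/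
theorem exists_hasQExpansion_toScalar : ∃ a : ℤ → ℂ, HasQExpansion (toScalar L p k F) a ∧
    ∀ n : ℤ, legendreSym p n = -quadraticChar (ZMod p) α → a n = 0 := by
  have hb := fun y : ZMod p => (exists_expansion_iff L h (φ.symm y) _).1 (hF.2.2 (φ.symm y))
  choose b hN hb0 hb using hb
  choose N hN using hN
  refine ⟨fun n => 1 / 2 * ∑ y, b y n, ⟨⟨Finset.univ.inf' ⟨0, Finset.mem_univ _⟩ N, fun n hn => ?_⟩,
    fun τ => ?_⟩, fun n hn => ?_⟩
  · simp only
    rw [Finset.sum_eq_zero, mul_zero]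
    exact fun y _ => hN y n (hn.trans_le (Finset.inf'_le _ (Finset.mem_univ y)))
  · rw [toScalar_apply L hp hL h hF]
    refine ((hasSum_sum fun y _ => hb y (scale p τ)).mul_left (1 / 2)).congr_fun fun n => ?_
    have hpc := prime_cast_ne_zero p
    have h1 : (n : ℂ) * (scale p τ) / p = n * τ := by
      rw [coe_scale]; field_simp
    rw [h1, ← Finset.sum_mul, mul_assoc]
  · simp only
    rw [Finset.sum_eq_zero, mul_zero]
    refine fun y _ => hb0 y n fun hy => ?_
    rw [AddEquiv.apply_symm_apply] at hy
    rw [legendreSym, hy, map_mul] at hn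
    have hα := quadraticChar_sq_one h.1
    by_cases hy0 : y = 0
    · rw [hy0] at hn
      simp only [ne_eq, OfNat.ofNat_ne_zero, not_false_eq_true, zero_pow, MulChar.map_zero,
        mul_zero] at hn
      rw [neg_eq_zero.1 hn.symm] at hα
      simp at hα
    · rw [map_pow, quadraticChar_sq_one hy0, mul_one] at hn
      have h2 : quadraticChar (ZMod p) α = 0 := by linarith
      rw [h2] at hα
      simp at hα

/-- Meromorphy at the cusps: up to a sign, a slash of the image of `F` is either that image itself
or, as `W_p S T^j` acts by `τ ↦ (τ + j) / p` up to scaling, a multiple of `F_0((τ + j) / p)`. -/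
theorem isMeromorphicAtInfty_toScalar (M : SL(2, ℤ)) :
    IsMeromorphicAtInfty p (slash k (toScalar L p k F) (M : GL (Fin 2) ℝ)) := by
  have hpc := prime_cast_ne_zero p
  have hppos : (0 : ℤ) < p := by exact_mod_cast (Fact.out : p.Prime).pos
  obtain ⟨x, hx, -⟩ := existsUnique_cosetRep p M
  have h1 : slash k (toScalar L p k F) (M : GL (Fin 2) ℝ) =
      fun τ => (legendreSym p ((M * (cosetRep p x)⁻¹) 1 1) : ℂ) *
        slash k (toScalar L p k F) (cosetRep p x : GL (Fin 2) ℝ) τ := by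
    rw [← slash_smul, ← slash_toScalar_Gamma0 L hp hL h hF _ hx, slash_slash_SL,
      inv_mul_cancel_right]
  rw [h1]
  suffices hs : IsMeromorphicAtInfty p
      (slash k (toScalar L p k F) (cosetRep p x : GL (Fin 2) ℝ)) by
    obtain ⟨c, ⟨N, hN⟩, hc⟩ := hs
    refine ⟨fun n => (legendreSym p ((M * (cosetRep p x)⁻¹) 1 1) : ℂ) * c n,
      ⟨N, fun n hn => by simp [hN n hn]⟩, fun τ => ?_⟩
    simpa only [mul_assoc] using (hc τ).mul_left
      (legendreSym p ((M * (cosetRep p x)⁻¹) 1 1) : ℂ)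
  have hinj : Function.Injective fun m : ℤ => (p : ℤ) * m := mul_right_injective₀ hppos.ne'
  rcases x with _ | j
  · obtain ⟨a, ⟨⟨N, hN⟩, ha⟩, -⟩ := exists_hasQExpansion_toScalar L hp hL h hF
    refine ⟨fun n => if (p : ℤ) ∣ n then a (n / p) else 0, ⟨N * p, fun n hn => ?_⟩, fun τ => ?_⟩
    · simp only
      rw [hN _ (Int.ediv_lt_of_lt_mul hppos hn), ite_self]
    · have h2 : slash k (toScalar L p k F) (cosetRep p none : GL (Fin 2) ℝ) τ =
          toScalar L p k F τ := by
        rw [slash_SL, denom_SL, cosetRep]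
        simp
      rw [h2, ← hinj.hasSum_iff]
      · refine (ha τ).congr_fun fun m => ?_
        simp only [Function.comp_apply, dvd_mul_right, if_true,
          Int.mul_ediv_cancel_left _ hppos.ne']
        push_cast
        rw [mul_assoc (p : ℂ), mul_div_cancel_left₀ _ hpc]
      · intro n hn
        simp only
        rw [if_neg, zero_mul]
        rintro ⟨m, rfl⟩
        exact hn ⟨m, rfl⟩
  · obtain ⟨b, ⟨N, hN⟩, hb0, hb⟩ := (exists_expansion_iff L h 0 _).1 (hF.2.2 0)
    set C : ℂ := Complex.I ^ (L.r / 2) / 2 * (((p : ℝ) ^ ((1 - (k : ℝ)) / 2) : ℝ) : ℂ)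
    have h2 : ∀ τ, slash k (toScalar L p k F) (cosetRep p (some j) : GL (Fin 2) ℝ) τ =
        C * ((((p : ℝ) ^ ((k : ℝ) / 2) : ℝ) : ℂ) * (-p) ^ (-k)) * F (shiftScale p j.val τ) 0 := by
      intro τ
      unfold toScalar
      rw [slash_smul, cosetRep]
      simp only [slash_fricke_ST]
      ring
    set C' : ℂ := C * ((((p : ℝ) ^ ((k : ℝ) / 2) : ℝ) : ℂ) * (-p) ^ (-k))
    refine ⟨fun m => C' * (b (p * m) * stdAddChar ((m * (j.val : ℤ) : ℤ) : ZMod p)),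
      -- any bound `≤ min(N, 0)` works: for `n < -|N|` also `p n < N`
      ⟨N.natAbs * (-1), fun n hn => ?_⟩, fun τ => ?_⟩
    · simp only
      rw [hN, zero_mul, mul_zero]
      have h3 : n ≤ -1 := by
        have := Int.natCast_nonneg N.natAbs
        omega
      have h4 : (p : ℤ) * n ≤ n := by nlinarith
      have h5 := neg_abs_le N
      rw [Int.abs_eq_natAbs] at h5
      linarith
    · rw [h2]
      have h3 := hb (shiftScale p j.val τ)
      rw [← hinj.hasSum_iff] at h3
      · refine (h3.mul_left C').congr_fun fun m => ?_
        simp only [Function.comp_apply]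
        have h4 : (((p * m : ℤ) : ℂ)) * shiftScale p j.val τ / p = m * shiftScale p j.val τ := by
          push_cast
          field_simp
        rw [h4, e_shiftScale]
        ring
      · intro n hn
        rw [hb0, zero_mul]
        rw [map_zero, zero_pow two_ne_zero, mul_zero]
        intro h0
        rw [intCast_zmod_eq_zero_iff_dvd] at h0
        obtain ⟨m, rfl⟩ := h0
        exact hn ⟨m, rfl⟩

theorem toScalar_mem_signedForms : toScalar L p k F ∈ signedForms p k (L.discSign p) := by
  refine ⟨⟨?_, fun M hM τ => ?_, isMeromorphicAtInfty_toScalar L hp hL h hF⟩, ?_⟩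
  · rw [funext (toScalar_apply L hp hL h hF)]
    exact mdifferentiable_const.mul
      (mdifferentiable_sum _ fun y => mdifferentiable_comp_scale p (hF.1 _))
  · rw [slash_toScalar_Gamma0 L hp hL h hF M hM]
  · rw [← EvenLattice.IsDiscIso.quadraticChar_eq L h]
    exact exists_hasQExpansion_toScalar L hp hL h hF

/-- Injectivity: `F_0` determines all components. From `F_0 = 0` the transformation law under
`S T^j` gives `∑_y e(j α y² / p) F_y = 0` for all `j`, so that sums of `F_y` over the solutions of
`y² = x²` vanish, and `F` is even by the law under `-1`. -/
theorem eq_zero_of_toScalar_eq_zero (hk : k ≡ L.r / 2 [ZMOD 2]) (h0 : toScalar L p k F = 0) :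
    F = 0 := by
  classical
  have hF0 : ∀ τ, F τ 0 = 0 := by
    intro τ
    have h1 := congrFun h0 (shiftScale p 0 (ModularGroup.S • τ))
    have h2 : scale p (shiftScale p 0 (ModularGroup.S • τ)) = ModularGroup.S • τ := by
      ext
      simp [mul_div_cancel₀ _ (prime_cast_ne_zero p)]
    rw [toScalar, slash_fricke, h2, S_smul_S_smul, ← coe_scale, h2, Pi.zero_apply] at h1
    have hpos := fun x : ℝ => Complex.ofReal_ne_zero.2 (Real.rpow_pos_of_pos (prime_pos p) x).ne'
    have hI : Complex.I ^ (L.r / 2) ≠ 0 := zpow_ne_zero _ Complex.I_ne_zero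
    have hS : ((ModularGroup.S • τ : ℍ) : ℂ) ^ (-k) ≠ 0 := zpow_ne_zero _ (UpperHalfPlane.ne_zero _)
    have h3 := (mul_eq_zero.1 h1).resolve_left (mul_ne_zero (div_ne_zero hI two_ne_zero) (hpos _))
    exact (mul_eq_zero.1 h3).resolve_left (mul_ne_zero (hpos _) hS)
  ext τ γ
  have heven : ∀ δ, F τ (-δ) = F τ δ := by
    intro δ
    have h1 := congrFun (hF.2.1 (-1) τ) δ
    have h2 : (-1 : SL(2, ℤ)) • τ = τ := by
      ext
      rw [coe_specialLinearGroup_apply]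
      simp
    rw [h2, Pi.smul_apply, weilRep_neg_one L hp hL h, denom_SL, ← h.neg_one_zpow L hp,
      ← neg_one_zpow_congr hk] at h1
    have h3 := neg_one_zpow_mul_self k
    simp only [Matrix.SpecialLinearGroup.coe_neg, Matrix.SpecialLinearGroup.coe_one,
      Matrix.neg_apply, Matrix.one_apply_ne one_ne_zero, Matrix.one_apply_eq, neg_zero,
      Int.cast_zero, Int.cast_neg, Int.cast_one, zero_mul, zero_add, smul_eq_mul] at h1
    linear_combination -h1 - F τ (-δ) * h3
  have hsum : ∀ j : ZMod p, ∑ y : ZMod p, stdAddChar (α * (j * y ^ 2)) * F τ (φ.symm y) = 0 := by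
    intro j
    have h1 := congrFun (hF.2.1 (ModularGroup.S * ModularGroup.T ^ (j.val : ℤ)) τ) 0
    rw [hF0, Pi.smul_apply, weilRep_ST_apply_zero L hp hL h, Int.cast_natCast, natCast_zmod_val,
      smul_eq_mul, eq_comm, mul_eq_zero] at h1
    rcases h1 with h1 | h1
    · exact absurd h1 (zpow_ne_zero _ (denom_ne_zero _ _))
    · exact (mul_eq_zero.1 h1).resolve_left (kappa_ne_zero L (p := p) hk)
  have hsol : ∑ y : ZMod p, (if y ^ 2 = φ γ ^ 2 then F τ (φ.symm y) else 0) = 0 := by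
    have h1 : ∑ j : ZMod p, stdAddChar (-(α * (j * φ γ ^ 2))) *
        ∑ y : ZMod p, stdAddChar (α * (j * y ^ 2)) * F τ (φ.symm y) = 0 := by
      simp [hsum]
    simp only [Finset.mul_sum] at h1
    rw [Finset.sum_comm] at h1
    have h2 : ∀ y : ZMod p, ∑ j : ZMod p, (stdAddChar (-(α * (j * φ γ ^ 2))) *
        (stdAddChar (α * (j * y ^ 2)) * F τ (φ.symm y)) : ℂ) =
        p * if y ^ 2 = φ γ ^ 2 then F τ (φ.symm y) else 0 := by
      intro y
      have h3 := sum_stdAddChar_mul (α * (y ^ 2 - φ γ ^ 2))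
      simp only [mul_eq_zero, h.1, false_or, sub_eq_zero] at h3
      rw [mul_ite, mul_zero, ← ite_zero_mul, ← h3, Finset.sum_mul]
      refine Finset.sum_congr rfl fun j _ => ?_
      rw [← mul_assoc, ← AddChar.map_add_eq_mul]
      congr 2
      ring
    simp only [h2] at h1
    rw [← Finset.mul_sum] at h1
    exact (mul_eq_zero.1 h1).resolve_left (prime_cast_ne_zero p)
  have hconst : ∀ y : ZMod p, (if y ^ 2 = φ γ ^ 2 then F τ (φ.symm y) else 0) =
      if y ^ 2 = φ γ ^ 2 then F τ γ else 0 := by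
    intro y
    split_ifs with hy
    · rcases sq_eq_sq_iff_eq_or_eq_neg.1 hy with rfl | rfl
      · rw [AddEquiv.symm_apply_apply]
      · rw [map_neg, AddEquiv.symm_apply_apply, heven]
    · rfl
  simp only [hconst] at hsol
  rw [← Finset.sum_filter, Finset.sum_const, nsmul_eq_mul, mul_eq_zero] at hsol
  rcases hsol with hcard | hsol
  · rw [Nat.cast_eq_zero, Finset.card_eq_zero] at hcard
    have : φ γ ∈ Finset.univ.filter fun y : ZMod p => y ^ 2 = φ γ ^ 2 := by simp
    rw [hcard] at this
    simp at this
  · exact hsol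

end ToScalar

theorem toScalar_induced {p : ℕ} [Fact p.Prime] (hp : p ≠ 2) (hL : Nat.card L.Disc = p)
    {φ : L.Disc ≃+ ZMod p} {α : ZMod p} (h : L.IsDiscIso p φ α) {k : ℤ}
    (hk : k ≡ L.r / 2 [ZMOD 2]) {f : ℍ → ℂ} (hf : f ∈ signedForms p k (L.discSign p)) :
    toScalar L p k (induced L p k f) = f := by
  classical
  have hmem := induced_mem_vectorForms L hp hL h hk hf
  obtain ⟨⟨hf1, hf2, -⟩, a, ha, hs⟩ := hf
  rw [← EvenLattice.IsDiscIso.quadraticChar_eq L h] at hs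
  ext τ
  rw [toScalar_apply L hp hL h hmem]
  simp only [induced_apply_eq_residuePart L hp hL h hk hf2 ha hs, AddEquiv.apply_symm_apply,
    L.basisVec_apply, add_mul, one_mul, Finset.sum_add_distrib, sum_residuePart p hp ha h.1 hs,
    shiftScale_zero_scale, EmbeddingLike.map_eq_zero_iff, ite_mul, zero_mul, Finset.sum_ite_eq',
    Finset.mem_univ, if_true]
  simp

/-- The map `F ↦ (i^{r/2} / 2) p^{(1-k)/2} F_0 ∣ W_p` from vector valued to scalar valued forms,
as a linear map. -/
noncomputable def toScalarLinear {p : ℕ} [Fact p.Prime] (hp : p ≠ 2) (hL : Nat.card L.Disc = p)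
    {φ : L.Disc ≃+ ZMod p} {α : ZMod p} (h : L.IsDiscIso p φ α) (k : ℤ) :
    vectorForms L k →ₗ[ℂ] signedForms p k (L.discSign p) where
  toFun F := ⟨toScalar L p k F, toScalar_mem_signedForms L hp hL h F.2⟩
  map_add' F G := by
    ext τ
    simp only [toScalar, slash, Submodule.coe_add, Pi.add_apply]
    ring
  map_smul' c F := by
    ext τ
    simp only [toScalar, slash, Submodule.coe_smul, Pi.smul_apply, smul_eq_mul, RingHom.id_apply]
    ring

theorem bijective_toScalarLinear {p : ℕ} [Fact p.Prime] (hp : p ≠ 2) (hL : Nat.card L.Disc = p)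
    {φ : L.Disc ≃+ ZMod p} {α : ZMod p} (h : L.IsDiscIso p φ α) {k : ℤ}
    (hk : k ≡ L.r / 2 [ZMOD 2]) : Function.Bijective (toScalarLinear L hp hL h k) := by
  constructor
  · refine (injective_iff_map_eq_zero _).2 fun F hF => Subtype.ext ?_
    exact eq_zero_of_toScalar_eq_zero L hp hL h F.2 hk (congrArg Subtype.val hF)
  · exact fun f => ⟨⟨induced L p k f, induced_mem_vectorForms L hp hL h hk f.2⟩,
      Subtype.ext (toScalar_induced L hp hL h hk f.2)⟩

end PrimeDisc

theorem theorem3p4 {V : Type*} [AddCommGroup V] [Module ℝ V] (L : EvenLattice V)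
    (p : ℕ) [Fact p.Prime] (hp : p ≠ 2) (hL : Nat.card L.Disc = p)
    (k : ℤ) (hk : k ≡ L.r / 2 [ZMOD 2]) :
    -- the Weil representation exists and is given by its formulas on `T` and `S`
    L.IsWeilRep L.weilRep ∧
    -- `(L'/L, q)` is isomorphic to `(𝔽_p, α x² / p)`, and `ε = χ_p(α)`
    (∃ (φ : L.Disc ≃+ ZMod p) (α : ZMod p), L.IsDiscIso p φ α ∧
      quadraticChar (ZMod p) α = L.discSign p) ∧
    -- the terms of the sum defining `F` depend only on the cosets `Γ₀(p) M`
    (∀ f ∈ signedForms p k (L.discSign p), ∀ g ∈ Gamma0 p, ∀ M : SL(2, ℤ),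
      inducedTerm L p k f (g * M) = inducedTerm L p k f M) ∧
    -- `F ∈ 𝒜_{k,ρ}` with its explicit expansions; `n ≡ p q(γ) mod p` is written `n / p = q(γ)` in
    -- `ℝ/ℤ`
    (∀ f ∈ signedForms p k (L.discSign p), ∀ a : ℤ → ℂ, HasQExpansion f a →
      induced L p k f ∈ vectorForms L k ∧
      (∀ τ : ℍ, HasSum (fun n : {n : ℤ // n ≡ 0 [ZMOD p]} => 2 * (a n * e ((n : ℤ) * τ / p)))
        (induced L p k f τ 0)) ∧
      (∀ γ : L.Disc, γ ≠ 0 → ∀ τ : ℍ,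
        HasSum (fun n : {n : ℤ // (((n : ℝ) / p : ℝ) : UnitAddCircle) = L.q γ} =>
          a n * e ((n : ℤ) * τ / p)) (induced L p k f τ γ))) ∧
    -- the two maps are mutually inverse isomorphisms
    (∃ Φ : signedForms p k (L.discSign p) ≃ₗ[ℂ] vectorForms L k,
      (∀ f, (Φ f : ℍ → L.Disc → ℂ) = induced L p k f) ∧
      (∀ F, (Φ.symm F : ℍ → ℂ) = toScalar L p k F) ∧
      (∀ F, ∀ τ : ℍ, (Φ.symm F : ℍ → ℂ) τ
        = 1 / 2 * ∑ᶠ γ : L.Disc, (F : ℍ → L.Disc → ℂ) (scale p τ) γ)) := by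
  classical
  obtain ⟨φ, α, h⟩ := L.exists_discIso p hp hL
  refine ⟨L.isWeilRep_weilRep hp hL,
    ⟨φ, α, h, EvenLattice.IsDiscIso.quadraticChar_eq L h⟩,
    fun f hf g hg M => inducedTerm_Gamma0_mul L hp hL h hf.1.2.1 g hg M,
    fun f hf a ha => ⟨induced_mem_vectorForms L hp hL h hk hf, ?_⟩, ?_⟩
  · obtain ⟨⟨-, hf2, -⟩, b, hb, hs⟩ := hf
    rw [← EvenLattice.IsDiscIso.quadraticChar_eq L h] at hs
    have hF := induced_apply_eq_residuePart L hp hL h hk hf2 hb hs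
    refine ⟨fun τ => ?_, fun γ hγ τ => ?_⟩
    · have h1 : induced L p k f τ 0 = 2 * residuePart p f 0 τ := by
        rw [hF, L.basisVec_apply, if_pos rfl, map_zero, zero_pow two_ne_zero, mul_zero]
        norm_num
      rw [h1]
      refine (hasSum_residuePart_subtype p ha (fun n => ?_) τ).mul_left 2
      rw [Int.modEq_zero_iff_dvd, ZMod.intCast_zmod_eq_zero_iff_dvd]
    · rw [hF, L.basisVec_apply, if_neg hγ, add_zero, one_mul]
      exact hasSum_residuePart_subtype p ha (fun n => intCast_div_eq_q_iff L h n γ) τ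
  · let Ψ := LinearEquiv.ofBijective _ (bijective_toScalarLinear L hp hL h hk)
    refine ⟨Ψ.symm, fun f => ?_, fun F => rfl, fun F τ => ?_⟩
    · have h1 : Ψ.symm f = ⟨induced L p k f, induced_mem_vectorForms L hp hL h hk f.2⟩ := by
        rw [LinearEquiv.symm_apply_eq]
        exact Subtype.ext (toScalar_induced L hp hL h hk f.2).symm
      rw [h1]
    · have h1 : ∑ᶠ γ : L.Disc, (F : ℍ → L.Disc → ℂ) (scale p τ) γ =
          ∑ y : ZMod p, (F : ℍ → L.Disc → ℂ) (scale p τ) (φ.symm y) := by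
        rw [← finsum_eq_sum_of_fintype]
        exact (finsum_comp_equiv φ.symm.toEquiv).symm
      rw [h1]
      exact toScalar_apply L hp hL h F.2 τ
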